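/- Let $(W,S)$ be a Coxeter system of finite rank, with length function $\ell$, Coxeter matrix $m(s,t)$ and set of reflections $R(W)=\{wsw^{-1}: w\in W,\ s\in S\}$. Let $(X,\mathrm{ht})$ be a transitive quasiparabolic $W$-set: a transitive $W$-set $X$ with a function $\mathrm{ht}:X\to\mathbb Z$ such that, for all $x\in X$, $s\in S$, $r\in R(W)$: (i) $|\mathrm{ht}(sx)-\mathrm{ht}(x)|\le 1$; (ii) if $\mathrm{ht}(rx)=\mathrm{ht}(x)$, then $rx=x$; (iii) if $\mathrm{ht}(rx)>\mathrm{ht}(x)$ and $\mathrm{ht}(srx)<\mathrm{ht}(sx)$, then $rx=sx$. Suppose that $X$ is even, i.e. $wx=x$ implies that $\ell(w)$ is even, and that $X$ has a $W$-minimal element $x_0$, i.e. $\mathrm{ht}(sx_0)\ge \mathrm{ht}(x_0)$ for all $s\in S$. Let $H_W(q)$ be the Hecke algebra over $\mathbb Z[q]$, generated by $T(s)$, $s\in S$, subject to the braid relations and $(T(s)-q)(T(s)+1)=0$, and for $w\in W$ with reduced expression $w=s_1\cdots s_k$ put $T(w)=T(s_1)\cdots T(s_k)$. Let $\epsilon\in\{q,-1\}$.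 Then the free $\mathbb Z[q]$-module on symbols $T(x)$, $x\in X$, has a unique $H_W(q)$-module structure with \[ T(s)T(x)=\begin{cases}T(sx)&\mathrm{ht}(sx)>\mathrm{ht}(x)\\ \epsilon\, T(x)&\mathrm{ht}(sx)=\mathrm{ht}(x)\\ (q-1)T(x)+qT(sx)&\mathrm{ht}(sx)<\mathrm{ht}(x).\end{cases} \] (The middle case does not occur, since $X$ is even.) Let $I_X\subset H_W(q)$ be the left ideal annihilating $T(x_0)$. For $x\in X$ let $\Gamma_x$ be the graph whose vertices are the $s\in S$ with $\mathrm{ht}(sx)=\mathrm{ht}(x)-1$, two distinct vertices $s,t$ being joined by an edge if $m(s,t)<\infty$ and the $\langle s,t\rangle$-orbit of $x$ has size $2m(s,t)$. A dihedral generator based at $x$ is an element \[ T(\underbrace{\cdots sts}_{k}\,w)-T(\underbrace{\cdots tst}_{k}\,w), \] where $s\ne t$ are non-adjacent vertices of $\Gamma_x$, the $\langle s,t\rangle$-orbit of $x$ has size $2k$ with $k\ge 1$, and $w\in W$ is such that $wx_0$ is the element of minimal height in this orbit and $\mathrm{ht}(wx_0)=\mathrm{ht}(x_0)+\ell(w)$.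 Then the left ideal $I_X$ has a generating set $G$ consisting of dihedral generators such that, for every $x\neq x_0$, the number of elements of $G$ that are dihedral generators based at $x$ is one less than the number of connected components of $\Gamma_x$ (and no element of $G$ is based at $x_0$, where $\Gamma_{x_0}$ is empty). If $X$ is finite, then $G$ is finite; in particular, $I_X$ is then finitely generated. -/

import Mathlib

open Polynomial

noncomputable section

namespace Quasiparabolic

/-! ### The Hecke algebra -/

/-- The product `T(s₁) T(s₂) ⋯ T(sₖ)` in the free algebra on the symbols `T(s)`. -/
def freeWord {B : Type*} (ω : List B) : FreeAlgebra ℤ[X] B :=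
  (ω.map (FreeAlgebra.ι ℤ[X])).prod

/-- The defining relations of the Hecke algebra: the braid relations (between the two alternating
words of length `m(s,t)`; an entry `M s t = 0` stands for `m(s,t) = ∞`, and then the relation is
the trivial `1 = 1`) and the quadratic relations `(T(s) - q)(T(s) + 1) = 0`. The variable `q` is
`Polynomial.X`. -/
inductive HeckeRel {B : Type*} (M : CoxeterMatrix B) :
    FreeAlgebra ℤ[X] B → FreeAlgebra ℤ[X] B → Prop
  | braid (s t : B) :
      HeckeRel M (freeWord (CoxeterSystem.alternatingWord s t (M s t)))
        (freeWord (CoxeterSystem.alternatingWord t s (M s t)))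
  | quadratic (s : B) :
      HeckeRel M
        ((FreeAlgebra.ι ℤ[X] s - algebraMap ℤ[X] (FreeAlgebra ℤ[X] B) X) *
          (FreeAlgebra.ι ℤ[X] s + 1)) 0

/-- The Hecke algebra `H_W(q)` over `ℤ[q]`. -/
abbrev HeckeAlgebra {B : Type*} (M : CoxeterMatrix B) : Type _ := RingQuot (HeckeRel M)

/-- The generator `T(s)` of the Hecke algebra. -/
def heckeGen {B : Type*} (M : CoxeterMatrix B) (s : B) : HeckeAlgebra M :=
  RingQuot.mkAlgHom ℤ[X] (HeckeRel M) (FreeAlgebra.ι ℤ[X] s)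

variable {B W : Type*} [Group W] {M : CoxeterMatrix B} (cs : CoxeterSystem M W)

/-- The element `T(w) = T(s₁) ⋯ T(sₖ)`, where `s₁ ⋯ sₖ` is a reduced expression of `w`. -/
def heckeT (w : W) : HeckeAlgebra M :=
  ((Classical.choose (cs.exists_isReduced w)).map (heckeGen M)).prod

/-! ### Quasiparabolic sets -/

variable {Y : Type*} [MulAction W Y] (ht : Y → ℤ)

/-- `(Y, ht)` is a scaled `W`-set. -/
def IsScaled : Prop := ∀ (s : B) (x : Y), |ht (cs.simple s • x) - ht x| ≤ 1

/-- `(Y, ht)` is a quasiparabolic `W`-set. -/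
structure IsQuasiparabolic : Prop where
  scaled : IsScaled cs ht
  qp1 : ∀ (r : W) (x : Y), cs.IsReflection r → ht (r • x) = ht x → r • x = x
  qp2 : ∀ (r : W) (x : Y) (s : B), cs.IsReflection r → ht x < ht (r • x) →
    ht (cs.simple s • r • x) < ht (cs.simple s • x) → r • x = cs.simple s • x

/-- `x` is `W`-minimal. -/
def IsWMinimal (x : Y) : Prop := ∀ s : B, ht x ≤ ht (cs.simple s • x)

variable (Y) in
/-- The `W`-set `Y` is even: all stabilizers consist of elements of even length. -/
def IsEven : Prop := ∀ (w : W) (x : Y), w • x = x → Even (cs.length w)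

/-! ### The Hecke module of a quasiparabolic set -/

open Classical in
/-- The endomorphism of the free `ℤ[q]`-module with basis `T(x)`, `x ∈ Y`, by which `T(s)` acts.
The parameter `ε` is the scalar for basis elements fixed by `s`: it is `q` for `H^+` and `-1`
for `H^-`. -/
def heckeOp (ε : ℤ[X]) (s : B) : Module.End ℤ[X] (Y →₀ ℤ[X]) :=
  Finsupp.linearCombination ℤ[X] fun x : Y ↦
    if ht x < ht (cs.simple s • x) then Finsupp.single (cs.simple s • x) 1
    else if ht (cs.simple s • x) = ht x then Finsupp.single x ε
    else Finsupp.single x (X - 1) + Finsupp.single (cs.simple s • x) X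

/-- The representation `φ` of the Hecke algebra on the free module with basis `Y` is the one in
which each `T(s)` acts by `heckeOp`. -/
def IsHeckeAction (ε : ℤ[X]) (φ : HeckeAlgebra M →ₐ[ℤ[X]] Module.End ℤ[X] (Y →₀ ℤ[X])) : Prop :=
  ∀ s : B, φ (heckeGen M s) = heckeOp cs ht ε s

/-- The annihilator of the basis vector `T(x₀)`, a left ideal of the Hecke algebra (`Ideal` means
left ideal). -/
def annIdeal (φ : HeckeAlgebra M →ₐ[ℤ[X]] Module.End ℤ[X] (Y →₀ ℤ[X])) (x₀ : Y) :
    Ideal (HeckeAlgebra M) where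
  carrier := {h | φ h (Finsupp.single x₀ 1) = 0}
  add_mem' {a b} ha hb := by
    have ha' : φ a (Finsupp.single x₀ 1) = 0 := ha
    have hb' : φ b (Finsupp.single x₀ 1) = 0 := hb
    simp [ha', hb']
  zero_mem' := by simp
  smul_mem' c h hh := by
    have hh' : φ h (Finsupp.single x₀ 1) = 0 := hh
    simp [hh']

/-! ### The graphs `Γ_x` and dihedral generators -/

/-- The orbit of `x` under the subgroup `⟨s, t⟩`. -/
def dihedralOrbit (s t : B) (x : Y) : Set Y :=
  MulAction.orbit (Subgroup.closure {cs.simple s, cs.simple t}) x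

/-- The vertices of `Γ_x`: the simple reflections lowering the height of `x`. -/
abbrev DescentAt (x : Y) : Type _ := {s : B // ht (cs.simple s • x) = ht x - 1}

/-- The graph `Γ_x`: an edge joins `s ≠ t` when `m(s,t)` is finite and the `⟨s, t⟩`-orbit of `x`
has size `2 m(s,t)`. -/
def descentGraph (x : Y) : SimpleGraph (DescentAt cs ht x) where
  Adj s t := s ≠ t ∧ M s.1 t.1 ≠ 0 ∧ (dihedralOrbit cs s.1 t.1 x).ncard = 2 * M s.1 t.1
  symm := ⟨fun s t h ↦ by
    have e : dihedralOrbit cs t.1 s.1 x = dihedralOrbit cs s.1 t.1 x := by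
      unfold dihedralOrbit
      rw [Set.pair_comm]
    rw [e, M.symmetric t.1 s.1]
    exact ⟨h.1.symm, h.2⟩⟩
  loopless := ⟨fun _ h ↦ h.1 rfl⟩

/-- `g` is a dihedral generator based at `x`: there are two distinct non-adjacent vertices `s, t`
of `Γ_x`, the `⟨s, t⟩`-orbit of `x` has size `2k`, its minimal element is `w x₀` with
`ht (w x₀) = ht x₀ + ℓ(w)`, and `g` is the difference of the `T(u w)` for the two alternating
products `u` of `k` factors `s, t`. -/
def IsDihedralGenerator (x₀ x : Y) (g : HeckeAlgebra M) : Prop :=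
  ∃ s t : DescentAt cs ht x, s ≠ t ∧ ¬ (descentGraph cs ht x).Adj s t ∧
    ∃ (k : ℕ) (w : W), 0 < k ∧ (dihedralOrbit cs s.1 t.1 x).ncard = 2 * k ∧
      w • x₀ ∈ dihedralOrbit cs s.1 t.1 x ∧
      (∀ z ∈ dihedralOrbit cs s.1 t.1 x, ht (w • x₀) ≤ ht z) ∧
      ht (w • x₀) = ht x₀ + cs.length w ∧
      g = heckeT cs (cs.wordProd (CoxeterSystem.alternatingWord s.1 t.1 k) * w) -
        heckeT cs (cs.wordProd (CoxeterSystem.alternatingWord t.1 s.1 k) * w)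

end Quasiparabolic

end

/-! Call `w` short if `ht (w • x₀) = ht x₀ + ℓ(w)`, and say that it lies over `w • x₀`. Short
elements lie over every point, since height is distance from `x₀` (`ht_eq_add_dist`). As `T(w) T(x₀)
= T(w x₀)` for short `w`, differences `T(a) - T(b)` of short elements over one point annihilate
`T(x₀)`. Conversely, a left ideal containing all these differences contains the annihilator
(`annIdeal_le_of_cong`).

Dihedral generators produce all of them, by induction on height. Over `x`, two short elements with a
common left descent are congruent: strip that letter. So only the vertices of `Γ_x` matter. For
vertices `s`, `t` the `⟨s, t⟩`-orbit is a polygon with top `x`, whose two sides give short elements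
starting with `s` and with `t`. If `s`, `t` are adjacent, the sides are equal in `W`; otherwise
their difference is a dihedral generator. A star linking the components of `Γ_x` therefore suffices
(`exists_generators_at`). The count is exact because the left descents of a short element are
pairwise adjacent (`IsShort.eq_or_adj`) and the `T(w)` are linearly independent.

Polygons come from axiom (iii): two alternating rising paths meet as soon as one of them peaks. The
half-length `j` of a polygon divides `m(s,t)`, so a braid relation of length `j` at its bottom
propagates to length `m(s,t)`; this gives the module. Applied to `W` with its length function, the
same theory yields Matsumoto's theorem and the independence of the `T(w)`. -/

namespace CoxeterSystem

open Module Real Polynomial.Chebyshev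

variable {B W : Type*} [Group W] {M : CoxeterMatrix B}

/-! ### The geometric representation and the order of a product of two simple reflections -/

variable (M) in
/-- The coroot functional of the simple root `i` in the geometric representation. -/
noncomputable def geomCoroot (i : B) : Dual ℝ (B →₀ ℝ) :=
  -- If `M i j = 0`, that is `m = ∞`, then `π / 0 = 0` gives the correct value `-2`.
  Finsupp.linearCombination ℝ fun j ↦ -2 * cos (π / M i j)

lemma geomCoroot_single (i j : B) :
    geomCoroot M i (Finsupp.single j 1) = -2 * cos (π / M i j) := by
  simp [geomCoroot]

lemma geomCoroot_self (i : B) : geomCoroot M i (Finsupp.single i 1) = 2 := by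
  simp [geomCoroot_single]

lemma geom_parameter (i j : B) :
    2 * cos (2 * π / M i j) = geomCoroot M i (Finsupp.single j 1) *
      geomCoroot M j (Finsupp.single i 1) - 2 := by
  rw [geomCoroot_single, geomCoroot_single, M.symmetric j i, mul_div_assoc, cos_two_mul]
  ring

lemma sin_two_pi_div_pos {m : ℕ} (hm : 3 ≤ m) : 0 < sin (2 * π / m) := by
  have h3 : (3 : ℝ) ≤ m := by exact_mod_cast hm
  apply sin_pos_of_pos_of_lt_pi
  · positivity
  · rw [div_lt_iff₀ (by linarith)]
    nlinarith [pi_pos]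

lemma S_eval_eq_div {m : ℕ} (hm : 3 ≤ m) (n : ℤ) :
    (S ℝ n).eval (2 * cos (2 * π / m)) = sin ((n + 1) * (2 * π / m)) / sin (2 * π / m) := by
  rw [eq_div_iff (sin_two_pi_div_pos hm).ne', S_two_mul_real_cos]

lemma geom_reflection_isLiftable :
    M.IsLiftable fun i ↦ (reflection (geomCoroot_self (M := M) i) :
      (B →₀ ℝ) ≃ₗ[ℝ] (B →₀ ℝ)) := by
  intro i j
  dsimp only
  by_cases hij : i = j
  · subst hij
    rw [M.diagonal, pow_one, mul_eq_one_iff_eq_inv, reflection_inv]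
  ext1 z
  rw [reflection_mul_reflection_pow_apply _ _ _ _ _ (geom_parameter i j)]
  -- Let `θ = 2π/m`. For `m = 2n` the factor `S (n-1)` is a multiple of `sin nθ = sin π`; for `m =
  -- 2n+1` the sum `S n + S (n-1)` vanishes because `(n+1)θ + nθ = 2π`.
  have key : ∀ m : ℕ, 3 ≤ m → ∀ u v : B →₀ ℝ, z +
      ((S ℝ ((m - 2) / 2)).eval (2 * cos (2 * π / m)) *
        ((S ℝ ((m - 1) / 2)).eval (2 * cos (2 * π / m)) +
          (S ℝ ((m - 3) / 2)).eval (2 * cos (2 * π / m)))) • u +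
      ((S ℝ ((m - 1) / 2)).eval (2 * cos (2 * π / m)) *
        ((S ℝ (m / 2)).eval (2 * cos (2 * π / m)) +
          (S ℝ ((m - 2) / 2)).eval (2 * cos (2 * π / m)))) • v = z := by
    intro m hm u v
    have hs := (sin_two_pi_div_pos hm).ne'
    obtain ⟨n, rfl | rfl⟩ := Nat.even_or_odd' m
    · have e1 : (((2 * n : ℕ) : ℤ) - 2) / 2 = n - 1 := by omega
      have e2 : (((2 * n : ℕ) : ℤ) - 1) / 2 = n - 1 := by omega
      have z0 : (S ℝ ((n : ℤ) - 1)).eval (2 * cos (2 * π / (2 * n : ℕ))) = 0 := by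
        rw [S_eval_eq_div hm]
        have : ((((n : ℤ) - 1 : ℤ) : ℝ) + 1) * (2 * π / (2 * n : ℕ)) = π := by
          have : (n : ℝ) ≠ 0 := by
            have : n ≠ 0 := by omega
            exact_mod_cast this
          push_cast
          field_simp
          ring
        rw [this]; simp
      rw [e1, e2, z0]; simp
    · have e1 : (((2 * n + 1 : ℕ) : ℤ) - 2) / 2 = n - 1 := by omega
      have e2 : (((2 * n + 1 : ℕ) : ℤ) - 1) / 2 = n := by omega
      have e3 : (((2 * n + 1 : ℕ) : ℤ) - 3) / 2 = n - 1 := by omega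
      have e4 : (((2 * n + 1 : ℕ) : ℤ)) / 2 = n := by omega
      have z0 : (S ℝ (n : ℤ)).eval (2 * cos (2 * π / (2 * n + 1 : ℕ))) +
          (S ℝ ((n : ℤ) - 1)).eval (2 * cos (2 * π / (2 * n + 1 : ℕ))) = 0 := by
        rw [S_eval_eq_div hm, S_eval_eq_div hm, ← add_div]
        have : (((n : ℤ) : ℝ) + 1) * (2 * π / (2 * n + 1 : ℕ)) =
            2 * π - ((((n : ℤ) - 1 : ℤ) : ℝ) + 1) * (2 * π / (2 * n + 1 : ℕ)) := by
          push_cast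
          field_simp
          ring
        rw [this, sin_two_pi_sub]; simp
      rw [e1, e2, e3, e4, z0]; simp
  rcases Nat.lt_or_ge (M i j) 3 with h | h
  · have hM1 := M.off_diagonal i j hij
    have h02 : M i j = 0 ∨ M i j = 2 := by omega
    rcases h02 with h | h
    · simp [h]
    -- For `m = 2` the quotient by `sin θ` is unavailable, but both pairings vanish.
    · have c : cos (2 * π / (2 : ℕ)) = -1 := by simp
      have g1 : geomCoroot M i (Finsupp.single j 1) = 0 := by simp [geomCoroot_single, h]
      have g2 : geomCoroot M j (Finsupp.single i 1) = 0 := by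
        simp [geomCoroot_single, M.symmetric j i, h]
      rw [g1, g2, h, c]
      norm_num
      module
  · exact key _ h _ _

/-- The product of two simple reflections has order at least `m(i, j)`. -/
theorem simple_mul_simple_pow_ne_one (cs : CoxeterSystem M W) {i j : B} (hij : i ≠ j) {k : ℕ}
    (hk : 0 < k) (hkM : M i j = 0 ∨ k < M i j) : (cs.simple i * cs.simple j) ^ k ≠ 1 := by
  intro h1
  have h2 := congrArg (cs.lift ⟨_, geom_reflection_isLiftable (M := M)⟩) h1
  rw [map_pow, map_mul, map_one, lift_apply_simple, lift_apply_simple] at h2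
  have h3 := LinearEquiv.congr_fun h2 (Finsupp.single i 1)
  rw [reflection_mul_reflection_pow_apply_self _ _ _ _ (geom_parameter i j)] at h3
  have h4 := DFunLike.congr_fun h3 i
  have h5 := DFunLike.congr_fun h3 j
  have hg : geomCoroot M j (Finsupp.single i 1) = -2 * cos (π / M i j) := by
    rw [geomCoroot_single, M.symmetric j i]
  simp [hij, hij.symm, hg] at h4 h5
  rcases hkM with h0 | hlt
  · simp [h0, S_eval_two] at h5
    omega
  · have hM1 : M i j ≠ 1 := M.off_diagonal i j hij
    rcases Nat.lt_or_ge (M i j) 3 with h | h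
    · have hM2 : M i j = 2 := by omega
      have hk1 : k = 1 := by omega
      subst hk1
      rw [hM2] at h4
      norm_num at h4
    · have hs := (sin_two_pi_div_pos h).ne'
      have hm3 : (3 : ℝ) ≤ M i j := by exact_mod_cast h
      have hc : cos (π / M i j) ≠ 0 := by
        apply ne_of_gt
        apply cos_pos_of_mem_Ioo
        constructor
        · have : 0 < π / M i j := by positivity
          linarith [pi_pos]
        · rw [div_lt_div_iff₀ (by linarith) (by norm_num)]
          nlinarith [pi_pos]
      have h6 : (S ℝ ((k : ℤ) - 1)).eval (2 * cos (2 * π / M i j)) = 0 := by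
        rcases h5 with h5 | h5
        · exact h5
        · exact absurd h5 hc
      rw [h6, add_zero] at h4
      rw [S_eval_eq_div h, div_eq_one_iff_eq hs] at h4
      rw [S_eval_eq_div h, div_eq_zero_iff, or_iff_left hs] at h6
      push_cast at h4 h6
      -- With `θ = 2π/m`: `sin kθ = 0` and `sin (k+1)θ = sin θ` force `cos kθ = 1`, impossible for
      -- `0 < kθ < 2π`.
      have hk2 : sin (k * (2 * π / M i j)) = 0 := by rw [← h6]; ring_nf
      have hadd : sin ((k + 1) * (2 * π / M i j)) =
          cos (k * (2 * π / M i j)) * sin (2 * π / M i j) := by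
        rw [add_mul, one_mul, sin_add, hk2]; ring
      rw [hadd] at h4
      have hc1 : cos (k * (2 * π / M i j)) = 1 := by
        apply mul_right_cancel₀ hs
        rw [h4, one_mul]
      rw [cos_eq_one_iff_of_lt_of_lt] at hc1
      · have : 0 < k * (2 * π / M i j) := by
          have : (0 : ℝ) < k := by exact_mod_cast hk
          positivity
        linarith
      · have : 0 ≤ k * (2 * π / M i j) := by positivity
        linarith [pi_pos]
      · rw [mul_div_assoc', div_lt_iff₀ (by linarith)]
        have : (k : ℝ) < M i j := by exact_mod_cast hlt
        nlinarith [pi_pos]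

end CoxeterSystem

namespace CoxeterSystem

variable {B W : Type*} [Group W] {M : CoxeterMatrix B} (cs : CoxeterSystem M W)

/-! ### The inversion cocycle and strong exchange -/

open Classical in
/-- The action of a simple reflection on signed group elements: conjugation, with a sign change at
the reflection itself. -/
noncomputable def signedConj (i : B) : Function.End (W × ZMod 2) := fun x ↦
  (cs.simple i * x.1 * cs.simple i, x.2 + if x.1 = cs.simple i then 1 else 0)

open Classical in
lemma signedConj_word (ω : List B) (t : W) (e : ZMod 2) :
    ((ω.map cs.signedConj).prod : Function.End (W × ZMod 2)) (t, e) =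
      (cs.wordProd ω * t * (cs.wordProd ω)⁻¹, e + (cs.rightInvSeq ω).count t) := by
  induction ω with
  | nil => simp [Function.End.one_def]
  | cons i ω ih =>
    rw [List.map_cons, List.prod_cons]
    change cs.signedConj i (_ : W × ZMod 2) = _
    rw [ih, signedConj]
    ext
    · simp [wordProd_cons, mul_assoc]
    · have : cs.wordProd ω * t * (cs.wordProd ω)⁻¹ = cs.simple i ↔
          (cs.wordProd ω)⁻¹ * cs.simple i * cs.wordProd ω = t := by
        constructor
        · intro h; rw [← h]; group
        · intro h; rw [← h]; group
      simp only [rightInvSeq, List.count_cons, this, beq_iff_eq, Nat.cast_add, Nat.cast_ite,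
        Nat.cast_one, Nat.cast_zero, add_assoc]

lemma reverse_alternatingWord_two_mul (i j : B) (m : ℕ) :
    (alternatingWord i j (2 * m)).reverse = alternatingWord j i (2 * m) := by
  apply List.ext_getElem
  · simp
  · intro k h1 h2
    simp only [List.length_reverse, length_alternatingWord] at h1
    rw [List.getElem_reverse]
    simp only [length_alternatingWord]
    rw [getElem_alternatingWord _ _ _ _ (by omega), getElem_alternatingWord _ _ _ _ h1]
    by_cases hk : Even k
    · rw [if_neg, if_pos] <;> grind
    · rw [if_pos, if_neg] <;> grind

lemma alternatingWord_two_mul_succ (i j : B) (k : ℕ) :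
    alternatingWord i j (2 * (k + 1)) = i :: j :: alternatingWord i j (2 * k) := by
  rw [show 2 * (k + 1) = 2 * k + 1 + 1 by ring, alternatingWord_succ', alternatingWord_succ']
  simp

/-- Since `(s_i s_j)^m = 1`, the second half of the sequence repeats the first. This evenness is
what makes the signed action respect the Coxeter relations. -/
lemma even_count_rightInvSeq_braid [DecidableEq W] (i j : B) (t : W) :
    Even ((cs.rightInvSeq (alternatingWord i j (2 * M i j))).count t) := by
  rw [← reverse_alternatingWord_two_mul, rightInvSeq_reverse, List.count_reverse]
  set f : ℕ → W := fun k ↦ cs.wordProd (alternatingWord i j (2 * k + 1)) with hf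
  have hl : cs.leftInvSeq (alternatingWord j i (2 * M i j)) =
      (List.range (M i j)).map f ++ (List.range (M i j)).map f := by
    apply List.ext_getElem
    · simp; ring
    · intro k h1 h2
      have hk : k < 2 * M i j := by simpa using h1
      rw [getElem_leftInvSeq_alternatingWord _ _ _ _ _ hk]
      rcases Nat.lt_or_ge k (M i j) with h | h
      · rw [List.getElem_append_left (by simpa using h)]
        simp [hf]
      · rw [List.getElem_append_right (by simpa using h)]
        simp only [hf, List.getElem_map, List.getElem_range, List.length_map, List.length_range]
        obtain ⟨l, rfl⟩ := Nat.exists_eq_add_of_le h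
        rw [prod_alternatingWord_eq_mul_pow, prod_alternatingWord_eq_mul_pow]
        have e1 : (2 * (M i j + l) + 1) / 2 = M i j + l := by omega
        have e2 : (2 * (M i j + l - M i j) + 1) / 2 = l := by omega
        rw [e1, e2, pow_add, simple_mul_simple_pow]
        simp
  rw [hl, List.count_append]
  exact ⟨_, rfl⟩

lemma signedConj_isLiftable : M.IsLiftable cs.signedConj := by
  classical
  intro i j
  have h : ∀ k : ℕ, (cs.signedConj i * cs.signedConj j) ^ k =
      ((alternatingWord i j (2 * k)).map cs.signedConj).prod := by
    intro k
    induction k with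
    | zero => simp [alternatingWord]
    | succ k ih => rw [pow_succ', ih, alternatingWord_two_mul_succ]; simp [mul_assoc]
  rw [h]
  funext ⟨t, e⟩
  rw [signedConj_word]
  have h1 : cs.wordProd (alternatingWord i j (2 * M i j)) = 1 := by
    rw [prod_alternatingWord_eq_mul_pow]
    simp
  have h2 := cs.even_count_rightInvSeq_braid i j t
  rw [h1, (ZMod.natCast_eq_zero_iff_even).2 h2]
  simp [Function.End.one_def]

/-- The permutation representation of a Coxeter group on signed group elements. -/
noncomputable def signedConjHom : W →* Function.End (W × ZMod 2) :=
  cs.lift ⟨_, cs.signedConj_isLiftable⟩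

lemma signedConjHom_simple (i : B) : cs.signedConjHom (cs.simple i) = cs.signedConj i :=
  cs.lift_apply_simple _ i

lemma signedConjHom_mul (u v : W) (x : W × ZMod 2) :
    cs.signedConjHom (u * v) x = cs.signedConjHom u (cs.signedConjHom v x) := by
  rw [map_mul]; rfl

open Classical in
lemma signedConjHom_wordProd (ω : List B) (t : W) (e : ZMod 2) :
    cs.signedConjHom (cs.wordProd ω) (t, e) =
      (cs.wordProd ω * t * (cs.wordProd ω)⁻¹, e + (cs.rightInvSeq ω).count t) := by
  rw [← signedConj_word, wordProd, map_list_prod, List.map_map]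
  rw [show cs.signedConjHom ∘ cs.simple = cs.signedConj from funext cs.signedConjHom_simple]

/-- The parity of the number of occurrences of `t` in an inversion sequence of `w`. -/
noncomputable def inversionParity (w t : W) : ZMod 2 := (cs.signedConjHom w (t, 0)).2

lemma signedConjHom_apply (w t : W) (e : ZMod 2) :
    cs.signedConjHom w (t, e) = (w * t * w⁻¹, e + cs.inversionParity w t) := by
  obtain ⟨ω, rfl⟩ := cs.wordProd_surjective w
  simp [inversionParity, signedConjHom_wordProd]

lemma inversionParity_mul (u v t : W) :
    cs.inversionParity (u * v) t =
      cs.inversionParity v t + cs.inversionParity u (v * t * v⁻¹) := by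
  conv_lhs => rw [inversionParity, signedConjHom_mul, signedConjHom_apply, signedConjHom_apply]
  simp

open Classical in
lemma inversionParity_simple (i : B) (t : W) :
    cs.inversionParity (cs.simple i) t = if t = cs.simple i then 1 else 0 := by
  simp [inversionParity, signedConjHom_simple, signedConj]

lemma inversionParity_one (t : W) : cs.inversionParity 1 t = 0 := by
  rw [inversionParity, map_one]; rfl

/-- For `t = u s u⁻¹` the contributions of `u` and `u⁻¹` cancel, by the cocycle rule for `u u⁻¹ =
1`; only that of `s` remains. -/
lemma IsReflection.inversionParity_self {t : W} (h : cs.IsReflection t) :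
    cs.inversionParity t t = 1 := by
  obtain ⟨u, i, rfl⟩ := h
  have h1 := cs.inversionParity_mul u u⁻¹ (u * cs.simple i * u⁻¹)
  rw [mul_inv_cancel, inversionParity_one] at h1
  rw [inversionParity_mul, inversionParity_mul]
  have e1 : u⁻¹ * (u * cs.simple i * u⁻¹) * u⁻¹⁻¹ = cs.simple i := by group
  rw [e1] at h1 ⊢
  rw [inversionParity_simple, if_pos rfl]
  have e2 : cs.simple i * cs.simple i * (cs.simple i)⁻¹ = cs.simple i := by simp
  rw [e2, add_left_comm, ← h1, add_zero]

lemma IsReflection.length_mul_lt_of_inversionParity {t : W} (w : W)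
    (hw : cs.inversionParity w t = 1) : cs.length (w * t) < cs.length w := by
  classical
  obtain ⟨ω, hω, rfl⟩ := cs.exists_isReduced w
  rw [inversionParity, signedConjHom_wordProd] at hw
  have hmem : t ∈ cs.rightInvSeq ω := by
    rw [← List.count_pos_iff]
    by_contra h0
    have : List.count t (cs.rightInvSeq ω) = 0 := by omega
    simp [this] at hw
  exact (cs.isRightInversion_of_mem_rightInvSeq hω hmem).2

/-- A reflection is a right inversion exactly when its inversion parity is odd. -/
lemma IsReflection.length_mul_lt_iff {t : W} (h : cs.IsReflection t) (w : W) :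
    cs.length (w * t) < cs.length w ↔ cs.inversionParity w t = 1 := by
  refine ⟨fun hlt ↦ ?_, IsReflection.length_mul_lt_of_inversionParity cs w⟩
  by_contra hne
  have h0 : cs.inversionParity w t = 0 := by
    revert hne
    generalize cs.inversionParity w t = a
    revert a
    decide
  have h1 : cs.inversionParity (w * t) t = 1 := by
    rw [inversionParity_mul, h.inversionParity_self]
    simp [h0]
  have := IsReflection.length_mul_lt_of_inversionParity cs _ h1
  rw [mul_assoc, h.mul_self, mul_one] at this
  omega

/-- Crossing a simple reflection changes the sign of only one reflection. -/
theorem IsReflection.eq_simple_of_length {r : W} (h : cs.IsReflection r) (w : W) (i : B)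
    (h1 : cs.length w < cs.length (r * w))
    (h2 : cs.length (cs.simple i * (r * w)) < cs.length (cs.simple i * w)) : r = cs.simple i := by
  -- Passing from `w` to `s w` changes the parity at `w⁻¹ r w` only if `r = s`.
  have ht : cs.IsReflection (w⁻¹ * r * w) := by simpa using h.conj w⁻¹
  have e : r * w = w * (w⁻¹ * r * w) := by group
  rw [e] at h1
  rw [e, ← mul_assoc, ht.length_mul_lt_iff, inversionParity_mul] at h2
  have h3 : cs.inversionParity w (w⁻¹ * r * w) ≠ 1 := by
    rw [ne_eq, ← ht.length_mul_lt_iff]; omega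
  have e2 : w * (w⁻¹ * r * w) * w⁻¹ = r := by group
  rw [e2, inversionParity_simple] at h2
  by_contra hne
  rw [if_neg hne, add_zero] at h2
  exact h3 h2

end CoxeterSystem

/-! ### Dihedral orbits in even quasiparabolic sets: polygons -/

namespace Quasiparabolic

open CoxeterSystem

variable {B W Y : Type*} [Group W] {M : CoxeterMatrix B} {cs : CoxeterSystem M W}
  [MulAction W Y] {ht : Y → ℤ}

variable (cs) in
/-- The alternating product of `n` factors `s`, `t` that ends with `t`. -/
def alt (s t : B) (n : ℕ) : W := cs.wordProd (alternatingWord s t n)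

@[simp] lemma alt_zero (s t : B) : alt cs s t 0 = 1 := by simp [alt, alternatingWord]

@[simp] lemma alt_one (s t : B) : alt cs s t 1 = cs.simple t := by simp [alt, alternatingWord]

lemma alt_succ (s t : B) (n : ℕ) : alt cs s t (n + 1) = alt cs t s n * cs.simple t := by
  rw [alt, alternatingWord_succ, wordProd_concat, alt]

lemma alt_succ' (s t : B) (n : ℕ) :
    alt cs s t (n + 1) = cs.simple (if Even n then t else s) * alt cs s t n := by
  rw [alt, alternatingWord_succ', wordProd_cons, alt]

lemma alt_succ_smul (s t : B) (n : ℕ) (p : Y) :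
    alt cs s t (n + 1) • p = cs.simple (if Even n then t else s) • alt cs s t n • p := by
  rw [alt_succ', mul_smul]

lemma ite_even_succ (s t : B) (n : ℕ) :
    (if Even (n + 1) then t else s) = if Even n then s else t := by
  by_cases h : Even n <;> simp [h, Nat.even_add_one]

lemma alt_inv_mul_alt (s t : B) (n : ℕ) :
    (alt cs t s n)⁻¹ * alt cs s t n = (cs.simple s * cs.simple t) ^ n := by
  induction n generalizing s t with
  | zero => simp
  | succ n ih =>
    have h := congrArg (·⁻¹) (ih s t)
    simp only [mul_inv_rev, inv_inv] at h
    rw [alt_succ, alt_succ, mul_inv_rev, mul_assoc, ← mul_assoc _ (alt cs t s n), h, inv_simple,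
      ← inv_pow, mul_inv_rev, inv_simple, inv_simple, ← mul_assoc, pow_succ]
    rw [← mul_assoc]
    congr 1
    exact (mul_pow_mul (cs.simple s) (cs.simple t) n).symm

lemma alt_smul_eq_iff (s t : B) (n : ℕ) (p : Y) :
    alt cs s t n • p = alt cs t s n • p ↔ (cs.simple s * cs.simple t) ^ n • p = p := by
  rw [← alt_inv_mul_alt, mul_smul, inv_smul_eq_iff]

lemma simple_smul_smul (s : B) (x : Y) : cs.simple s • cs.simple s • x = x := by
  rw [← mul_smul, simple_mul_simple_self, one_smul]

/-- In an even quasiparabolic set a simple reflection changes the height by exactly one. -/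
lemma IsQuasiparabolic.ht_simple (hqp : IsQuasiparabolic cs ht) (heven : IsEven cs Y) (s : B)
    (x : Y) : ht (cs.simple s • x) = ht x + 1 ∨ ht (cs.simple s • x) = ht x - 1 := by
  have h1 := abs_le.1 (hqp.scaled s x)
  have h2 : ht (cs.simple s • x) ≠ ht x := by
    intro h
    have := heven _ _ (hqp.qp1 _ x (cs.isReflection_simple s) h)
    rw [length_simple] at this
    exact absurd this (by decide)
  omega

/-- If the heights of the two alternating sequences through `p` first peak, they meet there. -/
lemma alt_smul_eq_of_peak (hqp : IsQuasiparabolic cs ht) {s t : B} {p : Y} {n : ℕ}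
    (h1 : ht (alt cs t s n • p) < ht (alt cs s t (n + 1) • p))
    (h2 : ht (alt cs s t (n + 2) • p) < ht (alt cs t s (n + 1) • p)) :
    alt cs s t (n + 1) • p = alt cs t s (n + 1) • p := by
  -- This reflection carries level `n` of one sequence to level `n + 1` of the other; axiom (iii)
  -- then identifies it there with the next simple step.
  have hr : cs.IsReflection (alt cs t s n * cs.simple t * (alt cs t s n)⁻¹) := ⟨_, _, rfl⟩
  have e : (alt cs t s n * cs.simple t * (alt cs t s n)⁻¹) • alt cs t s n • p =
      alt cs s t (n + 1) • p := by
    rw [← mul_smul, alt_succ]; simp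
  have := hqp.qp2 _ (alt cs t s n • p) (if Even n then s else t) hr (by rwa [e])
    (by rwa [e, ← alt_succ_smul, ← ite_even_succ, ← alt_succ_smul])
  rw [e] at this
  rw [this, alt_succ_smul t s]

variable (cs ht) in
/-- Both alternating sequences starting at `p` increase the height for the first `n` steps. -/
def Rises (s t : B) (p : Y) (n : ℕ) : Prop :=
  ∀ i ≤ n, ht (alt cs s t i • p) = ht p + i ∧ ht (alt cs t s i • p) = ht p + i

lemma Rises.symm {s t : B} {p : Y} {n : ℕ} (h : Rises cs ht s t p n) : Rises cs ht t s p n :=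
  fun i hi ↦ (h i hi).symm

lemma Rises.one {s t : B} {p : Y} (hs : ht (cs.simple s • p) = ht p + 1)
    (htt : ht (cs.simple t • p) = ht p + 1) : Rises cs ht s t p 1 := by
  intro i hi
  interval_cases i <;> simp [hs, htt]

lemma Rises.succ {s t : B} {p : Y} {n : ℕ} (h : Rises cs ht s t p n)
    (h1 : ht (alt cs s t (n + 1) • p) = ht p + (n + 1))
    (h2 : ht (alt cs t s (n + 1) • p) = ht p + (n + 1)) : Rises cs ht s t p (n + 1) := by
  intro i hi
  rcases Nat.lt_or_ge n i with hlt | hle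
  · obtain rfl : i = n + 1 := by omega
    exact ⟨by push_cast; exact h1, by push_cast; exact h2⟩
  · exact h i hle

lemma alt_add_two_smul_of_eq {s t : B} {p : Y} {i : ℕ}
    (h : alt cs s t (i + 1) • p = alt cs t s (i + 1) • p) :
    alt cs s t (i + 2) • p = alt cs t s i • p := by
  rw [alt_succ_smul, h, ite_even_succ, alt_succ_smul, simple_smul_smul]

/-- The two sequences do not meet as long as the heights still increase. -/
lemma Rises.ne {s t : B} {p : Y} {n i : ℕ} (h : Rises cs ht s t p n) (h0 : 0 < i) (hi : i < n) :
    alt cs s t i • p ≠ alt cs t s i • p := by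
  obtain ⟨i, rfl⟩ := Nat.exists_eq_succ_of_ne_zero h0.ne'
  intro he
  have h1 := (h (i + 2) hi).1
  rw [alt_add_two_smul_of_eq he, (h i (by omega)).2] at h1
  push_cast at h1
  omega

/-- By evenness a step that does not rise must fall, so level `n` is a peak. -/
lemma Rises.eq_of_fall (hqp : IsQuasiparabolic cs ht) (heven : IsEven cs Y) {s t : B} {p : Y}
    {n : ℕ} (hn : 0 < n) (h : Rises cs ht s t p n)
    (hf : ht (alt cs s t (n + 1) • p) ≠ ht p + (n + 1)) :
    alt cs s t n • p = alt cs t s n • p := by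
  obtain ⟨n, rfl⟩ := Nat.exists_eq_succ_of_ne_zero hn.ne'
  have ha := (h (n + 1) le_rfl).1
  have hb := (h (n + 1) le_rfl).2
  have hc := (h n (by omega)).2
  have hd := hqp.ht_simple heven (if Even (n + 1) then t else s) (alt cs s t (n + 1) • p)
  rw [← alt_succ_smul] at hd
  simp only [Nat.succ_eq_add_one] at *
  push_cast at *
  apply alt_smul_eq_of_peak hqp
  · omega
  · rw [hb]
    rcases hd with hd | hd
    · exact absurd (hd.trans (by rw [ha]; ring)) hf
    · have e : n + 2 = n + 1 + 1 := rfl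
      rw [e, hd, ha]
      omega

lemma Rises.eq_of_not_succ (hqp : IsQuasiparabolic cs ht) (heven : IsEven cs Y) {s t : B} {p : Y}
    {n : ℕ} (hn : 0 < n) (h : Rises cs ht s t p n) (hf : ¬ Rises cs ht s t p (n + 1)) :
    alt cs s t n • p = alt cs t s n • p := by
  by_cases h1 : ht (alt cs s t (n + 1) • p) = ht p + (n + 1)
  · by_cases h2 : ht (alt cs t s (n + 1) • p) = ht p + (n + 1)
    · exact absurd (h.succ h1 h2) hf
    · exact (h.symm.eq_of_fall hqp heven hn h2).symm
  · exact h.eq_of_fall hqp heven hn h1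

variable (cs ht) in
/-- The `⟨s, t⟩`-orbit of `p` is a polygon with `2 * j` vertices and bottom vertex `p`. -/
structure IsPolygon (s t : B) (p : Y) (j : ℕ) : Prop where
  pos : 0 < j
  rises : Rises cs ht s t p j
  meet : alt cs s t j • p = alt cs t s j • p

namespace IsPolygon

variable {s t : B} {p : Y} {j : ℕ}

lemma symm (h : IsPolygon cs ht s t p j) : IsPolygon cs ht t s p j :=
  ⟨h.pos, h.rises.symm, h.meet.symm⟩

lemma pow_smul_eq_iff (h : IsPolygon cs ht s t p j) (n : ℕ) :
    (cs.simple s * cs.simple t) ^ n • p = p ↔ j ∣ n := by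
  have hj : (cs.simple s * cs.simple t) ^ j • p = p := (alt_smul_eq_iff s t j p).1 h.meet
  constructor
  · intro hn
    have hmod : (cs.simple s * cs.simple t) ^ (n % j) • p = p := by
      rw [MulAction.pow_smul_eq_iff_minimalPeriod_dvd] at hn hj ⊢
      exact (Nat.dvd_mod_iff hj).2 hn
    rcases Nat.eq_zero_or_pos (n % j) with h0 | h0
    · exact Nat.dvd_of_mod_eq_zero h0
    · exact absurd ((alt_smul_eq_iff s t _ p).2 hmod) (h.rises.ne h0 (Nat.mod_lt _ h.pos))
  · intro hn
    rw [MulAction.pow_smul_eq_iff_minimalPeriod_dvd] at hj ⊢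
    exact hj.trans hn

/-- The divisor may be proper, which is why braid relations must later be propagated from length `j`
to its multiples. -/
lemma dvd (h : IsPolygon cs ht s t p j) : j ∣ M s t := by
  rw [← h.pow_smul_eq_iff, simple_mul_simple_pow, one_smul]

lemma simple_smul_alt_mem (u : B) (hu : u = s ∨ u = t) (n : ℕ) :
    cs.simple u • alt cs s t (n + 1) • p = alt cs s t (n + 2) • p ∨
      cs.simple u • alt cs s t (n + 1) • p = alt cs s t n • p := by
  by_cases h : u = if Even (n + 1) then t else s
  · left; rw [alt_succ_smul s t (n + 1), h]
  · right
    have : u = if Even n then t else s := by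
      rw [ite_even_succ] at h
      by_cases hn : Even n <;> simp [hn] at h ⊢ <;> tauto
    rw [alt_succ_smul s t n, this, simple_smul_smul]

lemma exists_simple_smul_eq (h : IsPolygon cs ht s t p j) (u : B) (hu : u = s ∨ u = t) {i : ℕ}
    (hi : i ≤ j) : ∃ k ≤ j, cs.simple u • alt cs s t i • p = alt cs s t k • p ∨
      cs.simple u • alt cs s t i • p = alt cs t s k • p := by
  rcases i with _ | i
  · refine ⟨1, h.pos, ?_⟩
    rcases hu with rfl | rfl <;> simp
  · rcases simple_smul_alt_mem (cs := cs) (p := p) u hu i with h1 | h1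
    · rcases Nat.lt_or_ge (i + 1) j with hlt | hge
      · exact ⟨i + 2, hlt, .inl h1⟩
      · obtain rfl : j = i + 1 := by omega
        exact ⟨i, by omega, .inr (h1.trans (alt_add_two_smul_of_eq h.meet))⟩
    · exact ⟨i, by omega, .inl h1⟩

lemma mem_orbit_iff (h : IsPolygon cs ht s t p j) (z : Y) :
    z ∈ dihedralOrbit cs s t p ↔ ∃ i ≤ j, z = alt cs s t i • p ∨ z = alt cs t s i • p := by
  constructor
  · rintro ⟨⟨g, hg⟩, rfl⟩
    change ∃ i ≤ j, g • p = _ ∨ g • p = _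
    induction hg using Subgroup.closure_induction_left with
    | one => exact ⟨0, by omega, by simp⟩
    | mul_left x hx y _ ih =>
      obtain ⟨u, hu, rfl⟩ : ∃ u, (u = s ∨ u = t) ∧ x = cs.simple u := by
        rcases hx with rfl | rfl
        exacts [⟨s, .inl rfl, rfl⟩, ⟨t, .inr rfl, rfl⟩]
      obtain ⟨i, hi, h1 | h1⟩ := ih
      · obtain ⟨k, hk, h2⟩ := h.exists_simple_smul_eq u hu hi
        exact ⟨k, hk, by rwa [mul_smul, h1]⟩
      · obtain ⟨k, hk, h2⟩ := h.symm.exists_simple_smul_eq u hu.symm hi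
        exact ⟨k, hk, by rw [mul_smul, h1]; exact h2.symm⟩
    | inv_mul_cancel x hx y _ ih =>
      obtain ⟨u, hu, rfl⟩ : ∃ u, (u = s ∨ u = t) ∧ x = cs.simple u := by
        rcases hx with rfl | rfl
        exacts [⟨s, .inl rfl, rfl⟩, ⟨t, .inr rfl, rfl⟩]
      rw [inv_simple]
      obtain ⟨i, hi, h1 | h1⟩ := ih
      · obtain ⟨k, hk, h2⟩ := h.exists_simple_smul_eq u hu hi
        exact ⟨k, hk, by rwa [mul_smul, h1]⟩
      · obtain ⟨k, hk, h2⟩ := h.symm.exists_simple_smul_eq u hu.symm hi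
        exact ⟨k, hk, by rw [mul_smul, h1]; exact h2.symm⟩
  · have hmem : ∀ n : ℕ, alt cs s t n ∈ Subgroup.closure {cs.simple s, cs.simple t} ∧
        alt cs t s n ∈ Subgroup.closure {cs.simple s, cs.simple t} := by
      intro n
      induction n with
      | zero => simp [one_mem]
      | succ n ih =>
        rw [alt_succ, alt_succ]
        exact ⟨mul_mem ih.2 (Subgroup.subset_closure (by simp)),
          mul_mem ih.1 (Subgroup.subset_closure (by simp))⟩
    rintro ⟨i, -, rfl | rfl⟩
    · exact ⟨⟨_, (hmem i).1⟩, rfl⟩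
    · exact ⟨⟨_, (hmem i).2⟩, rfl⟩

lemma eq_or_lt (h : IsPolygon cs ht s t p j) {z : Y} (hz : z ∈ dihedralOrbit cs s t p) :
    z = p ∨ ht p < ht z := by
  obtain ⟨i, hi, hz⟩ := (h.mem_orbit_iff z).1 hz
  rcases Nat.eq_zero_or_pos i with rfl | h0
  · left; simpa using hz
  · right
    have := h.rises i hi
    rcases hz with rfl | rfl <;> omega

lemma ncard_orbit (h : IsPolygon cs ht s t p j) : (dihedralOrbit cs s t p).ncard = 2 * j := by
  -- One side takes levels `0, …, j-1` and the other `1, …, j`, so bottom and top are counted once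
  -- each.
  have e : dihedralOrbit cs s t p = (fun i ↦ alt cs s t i • p) '' Set.Iio j ∪
      (fun i ↦ alt cs t s (i + 1) • p) '' Set.Iio j := by
    ext z
    rw [h.mem_orbit_iff]
    constructor
    · rintro ⟨i, hi, rfl | rfl⟩
      · rcases Nat.lt_or_ge i j with hlt | hge
        · exact .inl ⟨i, hlt, rfl⟩
        · obtain rfl : i = j := by omega
          obtain ⟨i, rfl⟩ := Nat.exists_eq_succ_of_ne_zero h.pos.ne'
          exact .inr ⟨i, by simp, h.meet.symm⟩
      · rcases i with _ | i
        · exact .inl ⟨0, h.pos, by simp⟩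
        · exact .inr ⟨i, by simpa using hi, rfl⟩
    · rintro (⟨i, hi, rfl⟩ | ⟨i, hi, rfl⟩)
      · exact ⟨i, le_of_lt hi, .inl rfl⟩
      · exact ⟨i + 1, hi, .inr rfl⟩
  rw [e, Set.ncard_union_eq, Set.InjOn.ncard_image, Set.InjOn.ncard_image]
  · simp [Set.ncard_eq_toFinset_card', two_mul]
  · intro a ha b hb hab
    have h1 := (h.rises (a + 1) ha).2
    have h2 := (h.rises (b + 1) hb).2
    simp only at hab
    rw [hab, h2] at h1
    push_cast at h1
    omega
  · intro a ha b hb hab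
    have h1 := (h.rises a (le_of_lt ha)).1
    have h2 := (h.rises b (le_of_lt hb)).1
    simp only at hab
    rw [hab, h2] at h1
    omega
  · rw [Set.disjoint_left]
    rintro _ ⟨a, ha, rfl⟩ ⟨b, hb, hab⟩
    have h1 := (h.rises a (le_of_lt ha)).1
    have h2 := (h.rises (b + 1) hb).2
    simp only at hab
    rw [hab, h1] at h2
    obtain rfl : a = b + 1 := by omega
    exact h.rises.ne (by omega) ha hab.symm

end IsPolygon

/-- A local minimum of a finite dihedral group is the bottom of a polygon. -/
lemma exists_isPolygon_of_bottom (hqp : IsQuasiparabolic cs ht) (heven : IsEven cs Y) {s t : B}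
    {p : Y} (hM : M s t ≠ 0) (hs : ht (cs.simple s • p) = ht p + 1)
    (htt : ht (cs.simple t • p) = ht p + 1) : ∃ j, IsPolygon cs ht s t p j := by
  have hex : ∃ n, ¬ Rises cs ht s t p (n + 2) := by
    refine ⟨M s t, fun h ↦ h.ne (Nat.pos_of_ne_zero hM) (by omega) ?_⟩
    rw [alt_smul_eq_iff, simple_mul_simple_pow, one_smul]
  classical
  have hspec := Nat.find_spec hex
  have hmin : ∀ m < Nat.find hex, ¬ ¬ Rises cs ht s t p (m + 2) := fun m hm ↦ Nat.find_min hex hm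
  set n := Nat.find hex
  have hr : Rises cs ht s t p (n + 1) := by
    rcases hn : n with _ | m
    · exact Rises.one hs htt
    · exact not_not.1 (hmin m (by omega))
  exact ⟨n + 1, by omega, hr, hr.eq_of_not_succ hqp heven (by omega) hspec⟩

/-- If one alternating sequence from a local minimum rises up to a local maximum, then it is one
half of a polygon. -/
lemma isPolygon_of_rise (hqp : IsQuasiparabolic cs ht) (heven : IsEven cs Y) {s t : B}
    {p : Y} {n : ℕ} (hn : 0 < n) (hs : ht (cs.simple s • p) = ht p + 1)
    (hr : ∀ i ≤ n, ht (alt cs s t i • p) = ht p + i)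
    (htop : ht (alt cs s t (n + 1) • p) < ht (alt cs s t n • p)) :
    IsPolygon cs ht s t p n := by
  have key : ∀ k, 0 < k → k ≤ n → Rises cs ht s t p k := by
    intro k hk
    induction k, hk using Nat.le_induction with
    | base =>
      intro h1
      exact Rises.one hs (by simpa using hr 1 h1)
    | succ k hk ih =>
      intro hkn
      have hk' := ih (by omega)
      have ha := hr (k + 1) hkn
      push_cast at ha
      refine hk'.succ ha ?_
      -- Otherwise the sequences meet at level `k`, and the first one would then go down along the
      -- second.
      by_contra hb
      have hm := (hk'.symm.eq_of_fall hqp heven (by omega) hb).symm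
      obtain ⟨k, rfl⟩ := Nat.exists_eq_succ_of_ne_zero (Nat.pos_iff_ne_zero.1 hk)
      have e := alt_add_two_smul_of_eq hm
      have e2 := (hk' k (by omega)).2
      simp only [Nat.succ_eq_add_one, add_assoc, Nat.reduceAdd] at ha
      rw [e, e2] at ha
      push_cast at ha
      omega
  refine ⟨hn, key n hn le_rfl, (key n hn le_rfl).eq_of_fall hqp heven hn ?_⟩
  have := hr n le_rfl
  omega

/-- Descending from a local maximum `x` through a set `P` of elements of bounded height. -/
lemma exists_isPolygon_of_top (hqp : IsQuasiparabolic cs ht) (heven : IsEven cs Y) {s t : B} {x : Y}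
    {P : Y → Prop} {c : ℤ} (hP : ∀ z u, P z → ht (cs.simple u • z) = ht z - 1 → P (cs.simple u • z))
    (hb : ∀ z, P z → c ≤ ht z) (hs : ht (cs.simple s • x) = ht x - 1)
    (htt : ht (cs.simple t • x) = ht x - 1) (hPx : P (cs.simple t • x)) :
    ∃ p j, P p ∧ IsPolygon cs ht s t p j ∧ alt cs s t j • p = x := by
  -- A rising alternating path from `z` to `x` is extended downwards until its start is a local
  -- minimum; the letters swap roles each time, and `d` bounds the height still available above `c`.
  have key : ∀ (d : ℕ) (s t : B) (z : Y) (n : ℕ), ht z - c ≤ d → P z → 0 < n →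
      ht (cs.simple s • x) = ht x - 1 → ht (cs.simple t • x) = ht x - 1 →
      (∀ i ≤ n, ht (alt cs s t i • z) = ht z + i) → alt cs s t n • z = x →
      ∃ p j, P p ∧ IsPolygon cs ht s t p j ∧ alt cs s t j • p = x := by
    intro d
    induction d with
    | zero =>
      intro s t z n hd hz hn hs htt hr hx
      rcases hqp.ht_simple heven s z with h | h
      · refine ⟨z, n, hz, isPolygon_of_rise hqp heven hn h hr ?_, hx⟩
        rw [alt_succ_smul, hx]
        split_ifs <;> omega
      · have := hb _ (hP z s hz h)
        push_cast at hd
        omega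
    | succ d ih =>
      intro s t z n hd hz hn hs htt hr hx
      rcases hqp.ht_simple heven s z with h | h
      · refine ⟨z, n, hz, isPolygon_of_rise hqp heven hn h hr ?_, hx⟩
        rw [alt_succ_smul, hx]
        split_ifs <;> omega
      · have hstep : ∀ i, alt cs t s (i + 1) • cs.simple s • z = alt cs s t i • z := by
          intro i
          rw [alt_succ, mul_smul, simple_smul_smul]
        obtain ⟨p, j, h1, h2, h3⟩ := ih t s (cs.simple s • z) (n + 1) (by push_cast at hd; omega)
          (hP z s hz h) (by omega) htt hs (by
            intro i hi
            rcases i with _ | i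
            · simp
            · rw [hstep, hr i (by omega), h]
              push_cast
              ring) (by rw [hstep, hx])
        exact ⟨p, j, h1, h2.symm, by rw [h2.symm.meet, h3]⟩
  refine key (ht (cs.simple t • x) - c).toNat s t (cs.simple t • x) 1 (Int.self_le_toNat _) hPx
    one_pos hs htt ?_ (by simp [simple_smul_smul])
  intro i hi
  interval_cases i
  · simp
  · simp [simple_smul_smul, htt]

end Quasiparabolic

namespace Quasiparabolic

open CoxeterSystem

variable {B W Y : Type*} [Group W] {M : CoxeterMatrix B} {cs : CoxeterSystem M W}
  [MulAction W Y] {ht : Y → ℤ}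

/-! ### Heights and distances from the minimal element -/

lemma IsScaled.ht_smul_le (h : IsScaled cs ht) (w : W) (x : Y) :
    ht (w • x) ≤ ht x + cs.length w := by
  have key : ∀ ω : List B, ht (cs.wordProd ω • x) ≤ ht x + ω.length := by
    intro ω
    induction ω with
    | nil => simp
    | cons i ω ih =>
      have := (abs_le.1 (h i (cs.wordProd ω • x))).2
      rw [wordProd_cons, mul_smul, List.length_cons]
      push_cast
      omega
  obtain ⟨ω, hω, rfl⟩ := cs.exists_isReduced w
  rw [hω.eq]
  exact key ω

variable (cs) in
/-- The least length of an element carrying `x₀` to `x`. -/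
noncomputable def dist (x₀ x : Y) : ℕ := sInf {n | ∃ w : W, w • x₀ = x ∧ cs.length w = n}

lemma dist_smul_le (x₀ : Y) (w : W) : dist cs x₀ (w • x₀) ≤ cs.length w :=
  Nat.sInf_le ⟨w, rfl, rfl⟩

lemma length_alt_le (s t : B) (n : ℕ) : cs.length (alt cs s t n) ≤ n := by
  simpa [alt] using cs.length_wordProd_le (alternatingWord s t n)

section dist

variable [MulAction.IsPretransitive W Y]

variable (cs) in
lemma exists_length_eq_dist (x₀ x : Y) : ∃ w : W, w • x₀ = x ∧ cs.length w = dist cs x₀ x := by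
  obtain ⟨w, hw⟩ := MulAction.exists_smul_eq W x₀ x
  exact Nat.sInf_mem (s := {n | ∃ w : W, w • x₀ = x ∧ cs.length w = n}) ⟨_, w, hw, rfl⟩

lemma dist_smul_le_add (x₀ x : Y) (w : W) : dist cs x₀ (w • x) ≤ cs.length w + dist cs x₀ x := by
  obtain ⟨v, rfl, hv⟩ := exists_length_eq_dist cs x₀ x
  rw [← mul_smul, ← hv]
  exact (dist_smul_le _ _).trans (cs.length_mul_le _ _)

lemma exists_simple_smul_dist {x₀ x : Y} (h : 0 < dist cs x₀ x) :
    ∃ s y, x = cs.simple s • y ∧ dist cs x₀ y + 1 = dist cs x₀ x := by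
  obtain ⟨w, hw, hl⟩ := exists_length_eq_dist cs x₀ x
  have hw1 : w ≠ 1 := by
    rintro rfl
    simp at hl
    omega
  obtain ⟨i, hi⟩ := cs.exists_leftDescent_of_ne_one hw1
  rw [isLeftDescent_iff] at hi
  refine ⟨i, (cs.simple i * w) • x₀, by rw [mul_smul, simple_smul_smul, hw], ?_⟩
  have h1 := dist_smul_le (cs := cs) x₀ (cs.simple i * w)
  have h2 := dist_smul_le_add (cs := cs) x₀ ((cs.simple i * w) • x₀) (cs.simple i)
  rw [length_simple, mul_smul, simple_smul_smul, hw] at h2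
  rw [mul_smul, hw] at h1 ⊢
  omega

/-- The height is the distance from the minimal element. -/
theorem ht_eq_add_dist (hqp : IsQuasiparabolic cs ht) (heven : IsEven cs Y) {x₀ : Y}
    (hx₀ : IsWMinimal cs ht x₀) (x : Y) : ht x = ht x₀ + dist cs x₀ x := by
  induction hn : dist cs x₀ x using Nat.strong_induction_on generalizing x with
  | _ n ih =>
  have hzero : ∀ y, dist cs x₀ y = 0 → y = x₀ := by
    intro y hy
    obtain ⟨w, hw, hl⟩ := exists_length_eq_dist cs x₀ y
    rw [hy, length_eq_zero_iff] at hl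
    rw [← hw, hl, one_smul]
  rcases Nat.eq_zero_or_pos n with rfl | hpos
  · rw [hzero x hn]; simp
  obtain ⟨s, y, rfl, hy⟩ := exists_simple_smul_dist (hn ▸ hpos)
  have hyt := ih _ (by omega) y rfl
  rcases hqp.ht_simple heven s y with h | h
  · rw [h, hyt]
    have : (dist cs x₀ y : ℤ) + 1 = n := by exact_mod_cast hy.trans hn
    omega
  exfalso
  have hy0 : 0 < dist cs x₀ y := by
    rcases Nat.eq_zero_or_pos (dist cs x₀ y) with h0 | h0
    · have := hx₀ s
      rw [hzero y h0] at h
      omega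
    · exact h0
  obtain ⟨t, z, rfl, hz⟩ := exists_simple_smul_dist hy0
  have hzt := ih _ (by omega) z rfl
  have hdesc : ht (cs.simple t • cs.simple t • z) = ht (cs.simple t • z) - 1 := by
    rw [simple_smul_smul, hzt, hyt]
    have : (dist cs x₀ z : ℤ) + 1 = dist cs x₀ (cs.simple t • z) := by exact_mod_cast hz
    omega
  -- The point `t z` is a local maximum for `s`, `t`. The predicate confines the descent to
  -- distances at most `n - 2`, where the induction hypothesis applies. Its neighbour `s t z` then
  -- lies nearer to `x₀` than `t z`, contradicting its distance `n`.
  obtain ⟨p, j, hp, hpoly, htop⟩ := exists_isPolygon_of_top hqp heven (c := ht x₀)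
    (P := fun z ↦ dist cs x₀ z + 2 ≤ n) (by
      intro z u hz hu
      have h1 := dist_smul_le_add (cs := cs) x₀ z (cs.simple u)
      rw [length_simple] at h1
      have h2 := ih _ (by omega) z rfl
      have h3 := ih _ (by omega) (cs.simple u • z) rfl
      omega) (by
      intro z hz
      rw [ih _ (by omega) z rfl]
      omega) h hdesc (by rw [simple_smul_smul]; omega)
  have hpt := ih _ (by omega) p rfl
  have hj := (hpoly.rises j le_rfl).1
  rw [htop] at hj
  obtain ⟨i, rfl⟩ := Nat.exists_eq_succ_of_ne_zero hpoly.pos.ne'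
  have hdist : dist cs x₀ (cs.simple s • cs.simple t • z) ≤ i + dist cs x₀ p := by
    have hs : s = (if Even i then t else s) ∨ s = (if Even i then s else t) := by
      split_ifs <;> simp
    rcases hs with hs | hs
    · rw [← htop, alt_succ_smul, ← hs, simple_smul_smul]
      exact (dist_smul_le_add _ _ _).trans (Nat.add_le_add_right (length_alt_le _ _ _) _)
    · rw [← htop, hpoly.meet, alt_succ_smul, ← hs, simple_smul_smul]
      exact (dist_smul_le_add _ _ _).trans (Nat.add_le_add_right (length_alt_le _ _ _) _)
  push_cast at hj
  omega

end dist

/-! ### The regular action -/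

/-- This makes the polygon theory and the Hecke module available for `W` itself. Condition (ii) is
vacuous, as reflections change the length; (iii) is a form of strong exchange. -/
lemma isQuasiparabolic_length : IsQuasiparabolic cs (fun w : W ↦ (cs.length w : ℤ)) where
  scaled s w := by
    rw [smul_eq_mul, abs_le]
    dsimp only
    rcases cs.length_simple_mul w s with h | h <;> omega
  qp1 r w hr h := by
    simp only [smul_eq_mul, Nat.cast_inj] at h
    exact absurd h (hr.length_mul_right_ne w)
  qp2 r w s hr h1 h2 := by
    simp only [smul_eq_mul, Nat.cast_lt] at h1 h2 ⊢
    rw [hr.eq_simple_of_length cs w s h1 h2]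

variable (cs) in
lemma isEven_regular : IsEven cs W := by
  intro w x h
  rw [smul_eq_mul, mul_eq_right] at h
  simp [h]

lemma isWMinimal_one : IsWMinimal cs (fun w : W ↦ (cs.length w : ℤ)) 1 := by
  intro s
  simp

end Quasiparabolic

namespace Quasiparabolic

open CoxeterSystem

/-! ### Braid relations for operators with a quadratic relation -/

section Braid

variable {B R N : Type*} [CommRing R] [AddCommGroup N] [Module R N]

/-- The alternating product of `n` of the operators `f s`, `f t`, ending with `f t`. -/
def altOp (f : B → Module.End R N) (s t : B) (n : ℕ) : Module.End R N :=
  ((alternatingWord s t n).map f).prod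

variable {f : B → Module.End R N}

@[simp] lemma altOp_zero (s t : B) : altOp f s t 0 = 1 := by simp [altOp, alternatingWord]

lemma altOp_succ_apply (s t : B) (n : ℕ) (y : N) :
    altOp f s t (n + 1) y = altOp f t s n (f t y) := by
  simp [altOp, alternatingWord_succ]

lemma altOp_succ_apply' (s t : B) (n : ℕ) (y : N) :
    altOp f s t (n + 1) y = f (if Even n then t else s) (altOp f s t n y) := by
  simp [altOp, alternatingWord_succ']

/-- For `j = n + 1` both sides equal `(q-1)` times the product of length `n + 1` plus `q` times that
of length `n`, at `y`. On the left the repeated letter is innermost; on the right the hypothesis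
makes it outermost. -/
lemma altOp_comm_apply {q : R} (hf : ∀ s y, f s (f s y) = (q - 1) • f s y + q • y) {s t : B}
    {j : ℕ} {y : N} (h : altOp f s t j y = altOp f t s j y) :
    altOp f s t j (f t y) = altOp f t s j (f t y) := by
  rcases j with _ | n
  · simp
  have h1 : altOp f s t (n + 1) (f t y) =
      (q - 1) • altOp f t s (n + 1) y + q • altOp f t s n y := by
    rw [altOp_succ_apply, hf, map_add, map_smul, map_smul, ← altOp_succ_apply, h]
  have h2 : altOp f t s (n + 1) (f t y) =
      (q - 1) • altOp f t s (n + 1) y + q • altOp f t s n y := by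
    rw [← altOp_succ_apply, altOp_succ_apply' s t, h, ite_even_succ, altOp_succ_apply' t s n y, hf]
  rw [h1, h2]

lemma altOp_comm_altOp {q : R} (hf : ∀ s y, f s (f s y) = (q - 1) • f s y + q • y) {s t : B}
    {j : ℕ} {y : N} (h : altOp f s t j y = altOp f t s j y) (n : ℕ) :
    altOp f s t j (altOp f s t n y) = altOp f t s j (altOp f s t n y) := by
  induction n with
  | zero => simpa using h
  | succ n ih =>
    rw [altOp_succ_apply']
    split_ifs
    · exact altOp_comm_apply hf ih
    · exact (altOp_comm_apply hf ih.symm).symm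

lemma altOp_add_apply (s t : B) (j n : ℕ) (y : N) :
    altOp f s t (j + n) y = (if Even n then altOp f s t j else altOp f t s j) (altOp f s t n y) := by
  induction n generalizing s t y with
  | zero => simp
  | succ n ih =>
    rw [← add_assoc, altOp_succ_apply, ih, ← altOp_succ_apply]
    by_cases h : Even n <;> simp [h, Nat.even_add_one]

/-- Cut the product into blocks of length `j`: the two blocks still agree on every vector reached
from `y`. -/
lemma altOp_eq_of_dvd {q : R} (hf : ∀ s y, f s (f s y) = (q - 1) • f s y + q • y) {s t : B}
    {j m : ℕ} {y : N} (h : altOp f s t j y = altOp f t s j y) (hm : j ∣ m) :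
    altOp f s t m y = altOp f t s m y := by
  obtain ⟨n, rfl⟩ := hm
  induction n with
  | zero => simp
  | succ n ih =>
    rw [mul_add, mul_one, add_comm, altOp_add_apply, altOp_add_apply t s, ← ih]
    have := altOp_comm_altOp hf h (j * n)
    split_ifs
    · exact this
    · exact this.symm

end Braid

/-! ### The Hecke algebra action -/

variable {B W Y : Type*} [Group W] {M : CoxeterMatrix B} {cs : CoxeterSystem M W}
  [MulAction W Y] {ht : Y → ℤ} {ε : ℤ[X]}

lemma heckeOp_single_of_lt {s : B} {x : Y} (h : ht x < ht (cs.simple s • x)) :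
    heckeOp cs ht ε s (Finsupp.single x 1) = Finsupp.single (cs.simple s • x) 1 := by
  simp [heckeOp, h]

lemma heckeOp_single_of_gt {s : B} {x : Y} (h : ht (cs.simple s • x) < ht x) :
    heckeOp cs ht ε s (Finsupp.single x 1) =
      (X - 1 : ℤ[X]) • Finsupp.single x 1 + (X : ℤ[X]) • Finsupp.single (cs.simple s • x) 1 := by
  simp [heckeOp, h.not_gt, h.ne]

lemma heckeOp_heckeOp (hqp : IsQuasiparabolic cs ht) (heven : IsEven cs Y) (s : B)
    (y : Y →₀ ℤ[X]) : heckeOp cs ht ε s (heckeOp cs ht ε s y) =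
      (X - 1 : ℤ[X]) • heckeOp cs ht ε s y + (X : ℤ[X]) • y := by
  have : heckeOp cs ht ε s ∘ₗ heckeOp cs ht ε s =
      (X - 1 : ℤ[X]) • heckeOp cs ht ε s + (X : ℤ[X]) • LinearMap.id := by
    refine Finsupp.lhom_ext' fun x ↦ LinearMap.ext_ring ?_
    simp only [LinearMap.comp_apply, Finsupp.lsingle_apply, LinearMap.add_apply,
      LinearMap.smul_apply, LinearMap.id_apply]
    rcases hqp.ht_simple heven s x with h | h
    · rw [heckeOp_single_of_lt (by omega), heckeOp_single_of_gt (by rw [simple_smul_smul]; omega),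
        simple_smul_smul]
    · rw [heckeOp_single_of_gt (by omega), map_add, map_smul, map_smul,
        heckeOp_single_of_gt (by omega),
        heckeOp_single_of_lt (x := cs.simple s • x) (by rw [simple_smul_smul]; omega),
        simple_smul_smul]
  exact LinearMap.congr_fun this y

lemma altOp_heckeOp_single {s t : B} {p : Y} {n : ℕ}
    (hr : ∀ i ≤ n, ht (alt cs s t i • p) = ht p + i) :
    altOp (heckeOp cs ht ε) s t n (Finsupp.single p 1) = Finsupp.single (alt cs s t n • p) 1 := by
  induction n with
  | zero => simp
  | succ n ih =>
    rw [altOp_succ_apply', ih (fun i hi ↦ hr i (by omega)), heckeOp_single_of_lt, alt_succ_smul]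
    rw [← alt_succ_smul, hr _ le_rfl, hr n (by omega)]
    push_cast
    omega

/-- At a local minimum of an `⟨s, t⟩`-orbit the polygon gives agreement at length `j ∣ m`. Elsewhere
`T(x)` is `T(s)` or `T(t)` applied to a lower basis vector, and `altOp_comm_apply` lifts the
relation. -/
lemma altOp_heckeOp_braid [MulAction.IsPretransitive W Y] (hqp : IsQuasiparabolic cs ht)
    (heven : IsEven cs Y) {x₀ : Y} (hx₀ : IsWMinimal cs ht x₀) (s t : B) :
    altOp (heckeOp cs ht ε) s t (M s t) = altOp (heckeOp cs ht ε) t s (M s t) := by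
  by_cases hM : M s t = 0
  · simp [hM]
  refine Finsupp.lhom_ext' fun x ↦ LinearMap.ext_ring ?_
  simp only [LinearMap.comp_apply, Finsupp.lsingle_apply]
  have hf := heckeOp_heckeOp (ε := ε) hqp heven
  induction hn : dist cs x₀ x using Nat.strong_induction_on generalizing x with
  | _ n ih =>
  have hd := ht_eq_add_dist hqp heven hx₀ x
  rcases hqp.ht_simple heven t x with h1 | h1
  · rcases hqp.ht_simple heven s x with h2 | h2
    · obtain ⟨j, hj⟩ := exists_isPolygon_of_bottom hqp heven hM h2 h1
      refine altOp_eq_of_dvd hf ?_ hj.dvd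
      rw [altOp_heckeOp_single fun i hi ↦ (hj.rises i hi).1,
        altOp_heckeOp_single fun i hi ↦ (hj.rises i hi).2, hj.meet]
    · have hd' := ht_eq_add_dist hqp heven hx₀ (cs.simple s • x)
      have := (altOp_comm_apply hf (ih _ (by omega) (cs.simple s • x) rfl).symm).symm
      rwa [heckeOp_single_of_lt (by rw [simple_smul_smul]; omega), simple_smul_smul] at this
  · have hd' := ht_eq_add_dist hqp heven hx₀ (cs.simple t • x)
    have := altOp_comm_apply hf (ih _ (by omega) (cs.simple t • x) rfl)
    rwa [heckeOp_single_of_lt (by rw [simple_smul_smul]; omega), simple_smul_smul] at this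

/-- The operators `heckeOp` define a unique representation of the Hecke algebra. -/
theorem existsUnique_isHeckeAction [MulAction.IsPretransitive W Y] (hqp : IsQuasiparabolic cs ht)
    (heven : IsEven cs Y) {x₀ : Y} (hx₀ : IsWMinimal cs ht x₀) (ε : ℤ[X]) :
    ∃! φ : HeckeAlgebra M →ₐ[ℤ[X]] Module.End ℤ[X] (Y →₀ ℤ[X]), IsHeckeAction cs ht ε φ := by
  have hrel : ∀ ⦃a b : FreeAlgebra ℤ[X] B⦄, HeckeRel M a b →
      FreeAlgebra.lift ℤ[X] (heckeOp cs ht ε) a = FreeAlgebra.lift ℤ[X] (heckeOp cs ht ε) b := by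
    have hword : ∀ ω : List B, FreeAlgebra.lift ℤ[X] (heckeOp cs ht ε) (freeWord ω) =
        (ω.map (heckeOp cs ht ε)).prod := by
      intro ω
      rw [freeWord, map_list_prod, List.map_map]
      congr 2
      funext s
      simp
    intro a b hab
    cases hab with
    | braid s t =>
      rw [hword, hword]
      exact altOp_heckeOp_braid hqp heven hx₀ s t
    | quadratic s =>
      refine LinearMap.ext fun y ↦ ?_
      have := heckeOp_heckeOp (ε := ε) hqp heven s y
      simp only [map_mul, map_sub, map_add, FreeAlgebra.lift_ι_apply, AlgHom.commutes, map_one,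
        map_zero, Module.End.mul_apply, LinearMap.sub_apply, LinearMap.add_apply,
        Module.End.one_apply, LinearMap.zero_apply, Module.algebraMap_end_apply, this]
      module
  refine ⟨RingQuot.liftAlgHom ℤ[X] ⟨FreeAlgebra.lift ℤ[X] (heckeOp cs ht ε), hrel⟩, ?_, ?_⟩
  · intro s
    rw [heckeGen, RingQuot.liftAlgHom_mkAlgHom_apply, FreeAlgebra.lift_ι_apply]
  · intro φ hφ
    apply RingQuot.ringQuot_ext'
    ext s : 2
    simpa [heckeGen] using hφ s

end Quasiparabolic

namespace Quasiparabolic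

open CoxeterSystem

variable {B W Y : Type*} [Group W] {M : CoxeterMatrix B} {cs : CoxeterSystem M W}
  [MulAction W Y] {ht : Y → ℤ} {ε : ℤ[X]}

/-! ### The standard elements of the Hecke algebra -/

variable (M) in
/-- The product of the generators of the Hecke algebra along a word. -/
noncomputable def genWord (ω : List B) : HeckeAlgebra M := (ω.map (heckeGen M)).prod

lemma genWord_cons (s : B) (ω : List B) : genWord M (s :: ω) = heckeGen M s * genWord M ω := by
  simp [genWord]

lemma genWord_append (ω ω' : List B) : genWord M (ω ++ ω') = genWord M ω * genWord M ω' := by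
  simp [genWord]

lemma mkAlgHom_freeWord (ω : List B) :
    RingQuot.mkAlgHom ℤ[X] (HeckeRel M) (freeWord ω) = genWord M ω := by
  rw [freeWord, map_list_prod, List.map_map]
  rfl

lemma genWord_braid (s t : B) :
    genWord M (alternatingWord s t (M s t)) = genWord M (alternatingWord t s (M s t)) := by
  rw [← mkAlgHom_freeWord, ← mkAlgHom_freeWord]
  exact RingQuot.mkAlgHom_rel _ (.braid s t)

lemma heckeAlgebra_sub_eq (a b : HeckeAlgebra M) : a - b = a + (-1 : ℤ[X]) • b := by
  have h : a + (-1 : ℤ[X]) • b + b = a := by module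
  exact (eq_sub_of_add_eq (G := HeckeAlgebra M) h).symm

lemma freeAlgebra_quadratic (s : B) :
    (FreeAlgebra.ι ℤ[X] s - algebraMap ℤ[X] (FreeAlgebra ℤ[X] B) X) * (FreeAlgebra.ι ℤ[X] s + 1) =
      FreeAlgebra.ι ℤ[X] s * FreeAlgebra.ι ℤ[X] s + ((1 - X : ℤ[X]) • FreeAlgebra.ι ℤ[X] s +
        (-X : ℤ[X]) • 1) := by
  rw [sub_mul, Algebra.algebraMap_eq_smul_one, smul_mul_assoc, one_mul, mul_add, mul_one,
    smul_add]
  have h (a b : FreeAlgebra ℤ[X] B) : b + a = b + ((1 - X : ℤ[X]) • a + (-X : ℤ[X]) • 1) +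
      ((X : ℤ[X]) • a + (X : ℤ[X]) • 1) := by module
  exact sub_eq_of_eq_add (h _ _)

lemma heckeGen_mul_self (s : B) :
    heckeGen M s * heckeGen M s = (X - 1 : ℤ[X]) • heckeGen M s + (X : ℤ[X]) • 1 := by
  have h := RingQuot.mkAlgHom_rel ℤ[X] (HeckeRel.quadratic (M := M) s)
  rw [freeAlgebra_quadratic, map_add, map_add, map_mul, map_smul, map_smul, map_zero, map_one] at h
  change heckeGen M s * heckeGen M s + ((1 - X : ℤ[X]) • heckeGen M s + (-X : ℤ[X]) • 1) = 0 at h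
  calc heckeGen M s * heckeGen M s = heckeGen M s * heckeGen M s +
      ((1 - X : ℤ[X]) • heckeGen M s + (-X : ℤ[X]) • 1) +
        ((X - 1 : ℤ[X]) • heckeGen M s + (X : ℤ[X]) • 1) := by module
    _ = _ := by rw [h, zero_add]

/-- Two simple reflections that both lower the length of `w` split off the longest element of
the dihedral group they generate. -/
lemma exists_isPolygon_length {w : W} {s t : B} (hst : s ≠ t)
    (hs : cs.length (cs.simple s * w) < cs.length w)
    (htt : cs.length (cs.simple t * w) < cs.length w) :
    M s t ≠ 0 ∧ ∃ p : W, IsPolygon cs (fun w : W ↦ (cs.length w : ℤ)) s t p (M s t) ∧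
      alt cs s t (M s t) * p = w := by
  have hs' := cs.length_simple_mul w s
  have ht' := cs.length_simple_mul w t
  obtain ⟨p, j, -, hp, hw⟩ := exists_isPolygon_of_top (cs := cs) isQuasiparabolic_length
    (isEven_regular cs) (s := s) (t := t) (x := w) (P := fun _ ↦ True) (c := 0)
    (fun _ _ _ _ ↦ trivial) (fun _ _ ↦ by positivity) (by rw [smul_eq_mul]; omega)
    (by rw [smul_eq_mul]; omega) trivial
  -- The regular action is free, so the polygon closes only when `(s t)^j = 1`; as `s t` has order
  -- exactly `m`, this forces `j = m`.
  have h1 : (cs.simple s * cs.simple t) ^ j = 1 := by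
    have := (hp.pow_smul_eq_iff j).2 dvd_rfl
    rwa [smul_eq_mul, mul_eq_right] at this
  have h2 : M s t ≠ 0 := fun h ↦ cs.simple_mul_simple_pow_ne_one hst hp.pos (.inl h) h1
  have h3 : ¬ j < M s t := fun h ↦ cs.simple_mul_simple_pow_ne_one hst hp.pos (.inr h) h1
  have h4 := Nat.le_of_dvd (Nat.pos_of_ne_zero h2) hp.dvd
  obtain rfl : j = M s t := by omega
  exact ⟨h2, p, hp, hw⟩

lemma isReduced_tail {s : B} {ω : List B} (h : cs.IsReduced (s :: ω)) : cs.IsReduced ω := by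
  simpa using h.drop 1

lemma length_simple_mul_lt_of_isReduced {s : B} {ω : List B} (h : cs.IsReduced (s :: ω)) :
    cs.length (cs.simple s * cs.wordProd (s :: ω)) < cs.length (cs.wordProd (s :: ω)) := by
  rw [h.eq, wordProd_cons, simple_mul_simple_cancel_left, (isReduced_tail h).eq]
  simp

/-- Matsumoto's theorem for the Hecke algebra. -/
theorem genWord_eq_of_isReduced {ω ω' : List B} (h : cs.IsReduced ω) (h' : cs.IsReduced ω')
    (he : cs.wordProd ω = cs.wordProd ω') : genWord M ω = genWord M ω' := by
  induction hn : ω.length using Nat.strong_induction_on generalizing ω ω' with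
  | _ n ih =>
  have hl : ω.length = ω'.length := by rw [← h.eq, ← h'.eq, he]
  have same : ∀ {u : B} {α β : List B}, cs.IsReduced (u :: α) → cs.IsReduced (u :: β) →
      cs.wordProd (u :: α) = cs.wordProd (u :: β) → (u :: α).length = n →
      genWord M (u :: α) = genWord M (u :: β) := by
    intro u α β hα hβ hab hlen
    rw [genWord_cons, genWord_cons]
    rw [wordProd_cons, wordProd_cons, mul_right_inj] at hab
    rw [ih α.length (by simp at hlen; omega) (isReduced_tail hα) (isReduced_tail hβ) hab rfl]
  rcases ω with _ | ⟨s, α⟩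
  · rw [List.length_nil] at hl
    rw [List.length_eq_zero_iff.1 hl.symm]
  rcases ω' with _ | ⟨t, β⟩
  · simp at hl
  by_cases hst : s = t
  · subst hst
    exact same h h' he hn
  obtain ⟨hM, p, hp, hw⟩ := exists_isPolygon_length hst (length_simple_mul_lt_of_isReduced h)
    (by rw [he]; exact length_simple_mul_lt_of_isReduced h')
  obtain ⟨γ, hγ, rfl⟩ := cs.exists_isReduced p
  have hred : ∀ (u v : B), (cs.length (alt cs u v (M s t) * cs.wordProd γ) : ℤ) =
      cs.length (cs.wordProd γ) + (M s t : ℕ) →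
      cs.IsReduced (alternatingWord u v (M s t) ++ γ) := by
    intro u v huv
    rw [CoxeterSystem.IsReduced, wordProd_append, List.length_append, length_alternatingWord,
      ← hγ.eq]
    rw [alt] at huv
    omega
  have hr1 := hred s t (hp.rises _ le_rfl).1
  have hr2 := hred t s (hp.rises _ le_rfl).2
  have hw1 : cs.wordProd (alternatingWord s t (M s t) ++ γ) = cs.wordProd (s :: α) := by
    rw [wordProd_append]; exact hw
  have hw2 : cs.wordProd (alternatingWord t s (M s t) ++ γ) = cs.wordProd (s :: α) := by
    rw [wordProd_append, ← hw]; exact hp.meet.symm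
  have hb : genWord M (alternatingWord s t (M s t) ++ γ) =
      genWord M (alternatingWord t s (M s t) ++ γ) := by
    rw [genWord_append, genWord_append, genWord_braid]
  obtain ⟨i, hi⟩ := Nat.exists_eq_succ_of_ne_zero hM
  -- The parity of `m` decides which alternating word begins with `s`. Each given word is compared
  -- with the one sharing its first letter, and `hb` links the two.
  simp only [hi, Nat.succ_eq_add_one, alternatingWord_succ', List.cons_append] at hb hr1 hr2 hw1 hw2
  by_cases hev : Even i
  · simp only [hev, if_true] at hb hr1 hr2 hw1 hw2
    rw [same h hr2 hw2.symm hn, ← hb]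
    exact (same h' hr1 (he.symm.trans hw1.symm) (by omega)).symm
  · simp only [hev, if_false] at hb hr1 hr2 hw1 hw2
    rw [same h hr1 hw1.symm hn, hb]
    exact (same h' hr2 (he.symm.trans hw2.symm) (by omega)).symm

lemma heckeT_wordProd {ω : List B} (h : cs.IsReduced ω) :
    heckeT cs (cs.wordProd ω) = genWord M ω := by
  have hs := Classical.choose_spec (cs.exists_isReduced (cs.wordProd ω))
  exact genWord_eq_of_isReduced hs.1 h hs.2.symm

variable (cs) in
@[simp] lemma heckeT_one : heckeT cs 1 = 1 := by
  have h : cs.IsReduced [] := by simp [CoxeterSystem.IsReduced]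
  simpa [genWord] using heckeT_wordProd h

lemma heckeT_simple_mul {s : B} {w : W} (h : cs.length (cs.simple s * w) = cs.length w + 1) :
    heckeT cs (cs.simple s * w) = heckeGen M s * heckeT cs w := by
  obtain ⟨ω, hω, rfl⟩ := cs.exists_isReduced w
  rw [← wordProd_cons] at h ⊢
  rw [heckeT_wordProd hω, heckeT_wordProd, genWord_cons]
  rw [CoxeterSystem.IsReduced, h, hω.eq, List.length_cons]

/-! ### Elements acting with full height -/

variable (cs ht) in
/-- `w` raises the height of `x₀` by its full length. -/
def IsShort (x₀ : Y) (w : W) : Prop := ht (w • x₀) = ht x₀ + cs.length w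

lemma IsShort.of_simple_mul (hsc : IsScaled cs ht) {x₀ : Y} {s : B} {v : W}
    (h : IsShort cs ht x₀ (cs.simple s * v)) (hl : cs.length (cs.simple s * v) = cs.length v + 1) :
    IsShort cs ht x₀ v := by
  unfold IsShort at *
  have h1 := hsc.ht_smul_le v x₀
  have h2 := (abs_le.1 (hsc s (v • x₀))).2
  rw [mul_smul] at h
  omega

lemma IsShort.simple_mul (hsc : IsScaled cs ht) {x₀ : Y} {s : B} {v : W}
    (h : IsShort cs ht x₀ v) (hl : ht (cs.simple s • v • x₀) = ht (v • x₀) + 1) :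
    IsShort cs ht x₀ (cs.simple s * v) ∧ cs.length (cs.simple s * v) = cs.length v + 1 := by
  unfold IsShort at *
  have h1 := hsc.ht_smul_le (cs.simple s * v) x₀
  have h2 := cs.length_simple_mul v s
  rw [mul_smul] at h1 ⊢
  omega

lemma IsShort.ht_simple_smul (hqp : IsQuasiparabolic cs ht) (heven : IsEven cs Y) {x₀ : Y} {s : B}
    {a : W} (h : IsShort cs ht x₀ a) (hs : cs.length (cs.simple s * a) < cs.length a) :
    ht (cs.simple s • a • x₀) = ht (a • x₀) - 1 := by
  unfold IsShort at *
  have h1 := hqp.scaled.ht_smul_le (cs.simple s * a) x₀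
  have h2 := hqp.ht_simple heven s (a • x₀)
  rw [mul_smul] at h1
  omega

lemma exists_isShort [MulAction.IsPretransitive W Y] (hqp : IsQuasiparabolic cs ht)
    (heven : IsEven cs Y) {x₀ : Y} (hx₀ : IsWMinimal cs ht x₀) (x : Y) :
    ∃ w : W, w • x₀ = x ∧ IsShort cs ht x₀ w := by
  obtain ⟨w, hw, hl⟩ := exists_length_eq_dist cs x₀ x
  refine ⟨w, hw, ?_⟩
  rw [IsShort, hw, ht_eq_add_dist hqp heven hx₀ x, hl]

lemma isHeckeAction_heckeT_single (hsc : IsScaled cs ht)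
    {φ : HeckeAlgebra M →ₐ[ℤ[X]] Module.End ℤ[X] (Y →₀ ℤ[X])} (hφ : IsHeckeAction cs ht ε φ)
    {x₀ : Y} {w : W} (h : IsShort cs ht x₀ w) :
    φ (heckeT cs w) (Finsupp.single x₀ 1) = Finsupp.single (w • x₀) 1 := by
  induction hn : cs.length w using Nat.strong_induction_on generalizing w with
  | _ n ih =>
  by_cases hw : w = 1
  · simp [hw]
  obtain ⟨s, hs⟩ := cs.exists_leftDescent_of_ne_one hw
  rw [isLeftDescent_iff] at hs
  obtain ⟨v, rfl⟩ : ∃ v, w = cs.simple s * v := ⟨cs.simple s * w, by simp⟩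
  rw [simple_mul_simple_cancel_left] at hs
  have hv := h.of_simple_mul hsc hs.symm
  rw [heckeT_simple_mul hs.symm, map_mul, Module.End.mul_apply, ih _ (by omega) hv rfl, hφ s,
    heckeOp_single_of_lt, mul_smul]
  unfold IsShort at h hv
  rw [mul_smul] at h
  omega

/-- A difference of two distinct standard elements determines both of them. -/
lemma heckeT_sub_heckeT_inj {a b a' b' : W} (hab : a ≠ b)
    (h : heckeT cs a - heckeT cs b = heckeT cs a' - heckeT cs b') : a = a' ∧ b = b' := by
  -- In the regular module `T(w)` sends `T(1)` to the basis vector `T(w)`, which gives linear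
  -- independence. The scalar `X` is immaterial, as simple reflections fix nothing.
  obtain ⟨φ, hφ, -⟩ := existsUnique_isHeckeAction (cs := cs) isQuasiparabolic_length
    (isEven_regular cs) isWMinimal_one X
  have key : ∀ w : W, φ (heckeT cs w) (Finsupp.single 1 1) = Finsupp.single w 1 := by
    intro w
    have := isHeckeAction_heckeT_single isQuasiparabolic_length.scaled hφ (x₀ := (1 : W)) (w := w)
      (by simp [IsShort])
    simpa using this
  rw [heckeAlgebra_sub_eq, heckeAlgebra_sub_eq] at h
  have h1 := congrArg (fun z ↦ φ z (Finsupp.single 1 1)) h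
  simp only [map_add, map_smul, LinearMap.add_apply, LinearMap.smul_apply, key, neg_smul, one_smul,
    ← sub_eq_add_neg] at h1
  have haa : a = a' := by
    by_contra hne
    have h2 := DFunLike.congr_fun h1 a
    classical
    simp only [Finsupp.sub_apply, Finsupp.single_apply, if_true, if_neg hab.symm,
      if_neg (Ne.symm hne)] at h2
    split_ifs at h2
    · have := congrArg (Polynomial.eval 0) h2
      norm_num at this
    · norm_num at h2
  subst haa
  refine ⟨rfl, ?_⟩
  rw [sub_right_inj] at h1
  exact Finsupp.single_left_injective one_ne_zero h1

end Quasiparabolic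

namespace Quasiparabolic

open CoxeterSystem

/-! ### Congruence modulo a left ideal -/

section Congruence

variable {R A : Type*} [CommRing R] [Semiring A] [Algebra R A]

variable (R) in
/-- Congruence modulo a left ideal of an algebra. -/
def Cong (J : Ideal A) (a b : A) : Prop := a + (-1 : R) • b ∈ J

variable {J : Ideal A} {a b c d : A}

lemma smul_mem_ideal (r : R) (h : a ∈ J) : r • a ∈ J := by
  rw [Algebra.smul_def]
  exact J.mul_mem_left _ h

variable (R) in
lemma Cong.refl (J : Ideal A) (a : A) : Cong R J a a := by
  have : a + (-1 : R) • a = 0 := by module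
  rw [Cong, this]
  exact J.zero_mem

lemma Cong.symm (h : Cong R J a b) : Cong R J b a := by
  have e : b + (-1 : R) • a = (-1 : R) • (a + (-1 : R) • b) := by module
  rw [Cong, e]
  exact smul_mem_ideal _ h

lemma Cong.trans (h : Cong R J a b) (h' : Cong R J b c) : Cong R J a c := by
  have e : a + (-1 : R) • c = (a + (-1 : R) • b) + (b + (-1 : R) • c) := by module
  rw [Cong, e]
  exact J.add_mem h h'

lemma Cong.mul_left (h : Cong R J a b) (c : A) : Cong R J (c * a) (c * b) := by
  have e : c * a + (-1 : R) • (c * b) = c * (a + (-1 : R) • b) := by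
    rw [mul_add, mul_smul_comm]
  rw [Cong, e]
  exact J.mul_mem_left _ h

lemma Cong.add (h : Cong R J a b) (h' : Cong R J c d) : Cong R J (a + c) (b + d) := by
  have e : a + c + (-1 : R) • (b + d) = (a + (-1 : R) • b) + (c + (-1 : R) • d) := by module
  rw [Cong, e]
  exact J.add_mem h h'

lemma Cong.smul (h : Cong R J a b) (r : R) : Cong R J (r • a) (r • b) := by
  have e : r • a + (-1 : R) • (r • b) = r • (a + (-1 : R) • b) := by module
  rw [Cong, e]
  exact smul_mem_ideal _ h

end Congruence

variable {B W Y : Type*} [Group W] {M : CoxeterMatrix B} {cs : CoxeterSystem M W}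
  [MulAction W Y] {ht : Y → ℤ} {ε : ℤ[X]} {x₀ : Y}

lemma cong_of_sub_mem {J : Ideal (HeckeAlgebra M)} {a b : HeckeAlgebra M} (h : a - b ∈ J) :
    Cong ℤ[X] J a b := by
  rwa [Cong, ← heckeAlgebra_sub_eq]

/-! ### Dihedral generators -/

lemma IsPolygon.orbit_top {s t : B} {p x : Y} {j : ℕ} (h : IsPolygon cs ht s t p j)
    (hx : alt cs s t j • p = x) : dihedralOrbit cs s t x = dihedralOrbit cs s t p :=
  MulAction.orbit_eq_iff.2 ((h.mem_orbit_iff _).2 ⟨j, le_rfl, .inl hx.symm⟩)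

/-- A squeeze: the height gain `ℓ(w) + i` is at most the length, which is at most `ℓ(w) + i`. -/
lemma IsPolygon.isShort_alt_mul (hsc : IsScaled cs ht) {s t : B} {w : W} {j : ℕ}
    (h : IsPolygon cs ht s t (w • x₀) j) (hw : IsShort cs ht x₀ w) {i : ℕ} (hi : i ≤ j) :
    IsShort cs ht x₀ (alt cs s t i * w) ∧ cs.length (alt cs s t i * w) = cs.length w + i := by
  unfold IsShort at *
  have h1 := hsc.ht_smul_le (alt cs s t i * w) x₀
  have h2 := cs.length_mul_le (alt cs s t i) w
  have h3 := length_alt_le (cs := cs) s t i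
  have h4 := (h.rises i hi).1
  rw [mul_smul] at h1 ⊢
  omega

lemma IsPolygon.length_simple_mul_lt (hsc : IsScaled cs ht) {s t : B} {w : W} {i : ℕ}
    (h : IsPolygon cs ht s t (w • x₀) (i + 1)) (hw : IsShort cs ht x₀ w) :
    cs.length (cs.simple (if Even i then t else s) * (alt cs s t (i + 1) * w)) <
      cs.length (alt cs s t (i + 1) * w) := by
  rw [(h.isShort_alt_mul hsc hw le_rfl).2, alt_succ', mul_assoc, simple_mul_simple_cancel_left,
    (h.isShort_alt_mul hsc hw (Nat.le_succ i)).2]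
  omega

/-- Two left descents of an element acting with full height are adjacent in the descent graph. -/
lemma IsShort.eq_or_adj (hqp : IsQuasiparabolic cs ht) {x : Y} {a : W}
    (ha : IsShort cs ht x₀ a) (hax : a • x₀ = x) (s t : DescentAt cs ht x)
    (hs : cs.length (cs.simple s.1 * a) < cs.length a)
    (htt : cs.length (cs.simple t.1 * a) < cs.length a) :
    s = t ∨ (descentGraph cs ht x).Adj s t := by
  by_cases hst : s = t
  · exact .inl hst
  right
  obtain ⟨hM, p, hp, hpa⟩ := exists_isPolygon_length (fun h ↦ hst (Subtype.ext h)) hs htt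
  -- Shortness passes from `a` down both sides of the polygon in `W`; `d` counts steps below the
  -- top.
  have hdown : ∀ u v : B, (∀ i ≤ M s.1 t.1, (cs.length (alt cs u v i * p) : ℤ) = cs.length p + i) →
      alt cs u v (M s.1 t.1) * p = a → ∀ d i, i + d = M s.1 t.1 →
        IsShort cs ht x₀ (alt cs u v i * p) := by
    intro u v hr hm d
    induction d with
    | zero =>
      intro i hi
      rw [add_zero] at hi
      rw [hi, hm]
      exact ha
    | succ d ih =>
      intro i hi
      have h1 := ih (i + 1) (by omega)
      have h2 := hr (i + 1) (by omega)
      have h3 := hr i (by omega)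
      rw [alt_succ', mul_assoc] at h1 h2
      refine h1.of_simple_mul hqp.scaled ?_
      push_cast at h2
      omega
  have hr1 : ∀ i ≤ M s.1 t.1, (cs.length (alt cs s.1 t.1 i * p) : ℤ) = cs.length p + i :=
    fun i hi ↦ (hp.rises i hi).1
  have hr2 : ∀ i ≤ M s.1 t.1, (cs.length (alt cs t.1 s.1 i * p) : ℤ) = cs.length p + i :=
    fun i hi ↦ (hp.rises i hi).2
  have hmeet : alt cs s.1 t.1 (M s.1 t.1) * p = alt cs t.1 s.1 (M s.1 t.1) * p := hp.meet
  have hsh1 := hdown s.1 t.1 hr1 hpa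
  have hsh2 := hdown t.1 s.1 hr2 (hmeet ▸ hpa)
  have hp0 : ht (p • x₀) = ht x₀ + cs.length p := by
    simpa [IsShort] using hsh1 (M s.1 t.1) 0 (by omega)
  -- Heights in `Y` copy lengths in `W`, so the image polygon still has full size `2m`: this is
  -- adjacency.
  have hpoly : IsPolygon cs ht s.1 t.1 (p • x₀) (M s.1 t.1) := by
    refine ⟨Nat.pos_of_ne_zero hM, fun i hi ↦ ⟨?_, ?_⟩, ?_⟩
    · have := hsh1 (M s.1 t.1 - i) i (by omega)
      rw [IsShort, mul_smul, hr1 i hi] at this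
      rw [this, hp0]; ring
    · have := hsh2 (M s.1 t.1 - i) i (by omega)
      rw [IsShort, mul_smul, hr2 i hi] at this
      rw [this, hp0]; ring
    · rw [← mul_smul, hmeet, mul_smul]
  refine ⟨hst, hM, ?_⟩
  have htop : alt cs s.1 t.1 (M s.1 t.1) • p • x₀ = x := by rw [← mul_smul, hpa, hax]
  rw [hpoly.orbit_top htop, hpoly.ncard_orbit]

/-- A polygon with non-adjacent descents at its top is not the full dihedral one. -/
lemma IsPolygon.alt_ne {x p : Y} {s t : DescentAt cs ht x} (hst : s ≠ t)
    (hadj : ¬ (descentGraph cs ht x).Adj s t) {j : ℕ} (h : IsPolygon cs ht s.1 t.1 p j)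
    (hx : alt cs s.1 t.1 j • p = x) : alt cs s.1 t.1 j ≠ alt cs t.1 s.1 j := by
  intro he
  have h1 : (cs.simple s.1 * cs.simple t.1) ^ j = 1 := by
    rw [← alt_inv_mul_alt, he, inv_mul_cancel]
  have hne : s.1 ≠ t.1 := fun h ↦ hst (Subtype.ext h)
  have h2 : M s.1 t.1 ≠ 0 := fun h0 ↦ cs.simple_mul_simple_pow_ne_one hne h.pos (.inl h0) h1
  have h3 : ¬ j < M s.1 t.1 := fun h0 ↦ cs.simple_mul_simple_pow_ne_one hne h.pos (.inr h0) h1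
  have h4 := Nat.le_of_dvd (Nat.pos_of_ne_zero h2) h.dvd
  obtain rfl : j = M s.1 t.1 := by omega
  refine hadj ⟨hst, h2, ?_⟩
  rw [← h.ncard_orbit, h.orbit_top hx]

section Transitive

variable [MulAction.IsPretransitive W Y]

lemma exists_isPolygon_descents (hqp : IsQuasiparabolic cs ht) (heven : IsEven cs Y)
    (hx₀ : IsWMinimal cs ht x₀) {x : Y} (s t : DescentAt cs ht x) :
    ∃ (j : ℕ) (w : W), IsShort cs ht x₀ w ∧ IsPolygon cs ht s.1 t.1 (w • x₀) j ∧
      alt cs s.1 t.1 j • w • x₀ = x := by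
  obtain ⟨p, j, -, hp, hx⟩ := exists_isPolygon_of_top hqp heven (P := fun _ ↦ True) (c := ht x₀)
    (fun _ _ _ _ ↦ trivial) (fun z _ ↦ by rw [ht_eq_add_dist hqp heven hx₀ z]; omega) s.2 t.2
    trivial
  obtain ⟨w, rfl, hw⟩ := exists_isShort hqp heven hx₀ p
  exact ⟨j, w, hw, hp, hx⟩

lemma IsDihedralGenerator.exists_sub (hqp : IsQuasiparabolic cs ht) (heven : IsEven cs Y)
    (hx₀ : IsWMinimal cs ht x₀) {x : Y} {g : HeckeAlgebra M}
    (h : IsDihedralGenerator cs ht x₀ x g) :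
    ∃ a b : W, a ≠ b ∧ a • x₀ = x ∧ b • x₀ = x ∧ IsShort cs ht x₀ a ∧ IsShort cs ht x₀ b ∧
      g = heckeT cs a - heckeT cs b := by
  obtain ⟨s, t, hst, hadj, k, w, -, hk, hmem, hmin, hw, rfl⟩ := h
  obtain ⟨j, v, hv, hp, hx⟩ := exists_isPolygon_descents hqp heven hx₀ s t
  have horb : dihedralOrbit cs s.1 t.1 x = dihedralOrbit cs s.1 t.1 (v • x₀) :=
    hp.orbit_top hx
  rw [horb] at hk hmem hmin
  -- A polygon has a unique lowest point.
  have hwv : w • x₀ = v • x₀ := by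
    have := hmin (v • x₀) (MulAction.mem_orbit_self _)
    rcases hp.eq_or_lt hmem with h | h
    · exact h
    · omega
  rw [hp.ncard_orbit] at hk
  obtain rfl : k = j := by omega
  rw [← hwv] at hp hx
  refine ⟨alt cs s.1 t.1 k * w, alt cs t.1 s.1 k * w, ?_, ?_, ?_,
    (hp.isShort_alt_mul hqp.scaled hw le_rfl).1, (hp.symm.isShort_alt_mul hqp.scaled hw le_rfl).1,
    rfl⟩
  · rw [ne_eq, mul_left_inj]
    exact hp.alt_ne hst hadj hx
  · rw [mul_smul, hx]
  · rw [mul_smul, ← hp.meet, hx]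

lemma IsDihedralGenerator.base_eq (hqp : IsQuasiparabolic cs ht) (heven : IsEven cs Y)
    (hx₀ : IsWMinimal cs ht x₀) {x y : Y} {g : HeckeAlgebra M}
    (hx : IsDihedralGenerator cs ht x₀ x g) (hy : IsDihedralGenerator cs ht x₀ y g) : x = y := by
  obtain ⟨a, b, hab, rfl, -, -, -, rfl⟩ := hx.exists_sub hqp heven hx₀
  obtain ⟨c, d, -, rfl, -, -, -, he⟩ := hy.exists_sub hqp heven hx₀
  rw [(heckeT_sub_heckeT_inj hab he).1]

/-- The generators attached to a star on the components of the descent graph at `x`. -/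
theorem exists_generators_at (hqp : IsQuasiparabolic cs ht) (heven : IsEven cs Y)
    (hx₀ : IsWMinimal cs ht x₀) {x : Y} (hx : x ≠ x₀) :
    ∃ G : Set (HeckeAlgebra M), (∀ g ∈ G, IsDihedralGenerator cs ht x₀ x g) ∧
      G.encard + 1 = ENat.card (descentGraph cs ht x).ConnectedComponent ∧
      ∀ J : Ideal (HeckeAlgebra M), G ⊆ J →
        (∀ (a b : W), IsShort cs ht x₀ a → IsShort cs ht x₀ b → a • x₀ = b • x₀ →
          ht (a • x₀) < ht x → Cong ℤ[X] J (heckeT cs a) (heckeT cs b)) →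
        ∀ (a b : W), IsShort cs ht x₀ a → IsShort cs ht x₀ b → a • x₀ = x → b • x₀ = x →
          Cong ℤ[X] J (heckeT cs a) (heckeT cs b) := by
  have hdesc : ∀ a : W, IsShort cs ht x₀ a → a • x₀ = x →
      ∃ s : DescentAt cs ht x, cs.length (cs.simple s.1 * a) < cs.length a := by
    rintro a ha rfl
    have ha1 : a ≠ 1 := by
      rintro rfl
      simp at hx
    obtain ⟨s, hs⟩ := cs.exists_leftDescent_of_ne_one ha1
    exact ⟨⟨s, ha.ht_simple_smul hqp heven hs⟩, hs⟩
  obtain ⟨a₀, ha₀x, ha₀⟩ := exists_isShort hqp heven hx₀ x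
  obtain ⟨s₀, -⟩ := hdesc a₀ ha₀ ha₀x
  choose j w hw hp htop using fun s t ↦ exists_isPolygon_descents hqp heven hx₀ (x := x) s t
  set Γ := descentGraph cs ht x
  set σ : Γ.ConnectedComponent → DescentAt cs ht x := fun C ↦ C.out
  have hσC : ∀ C, Γ.connectedComponentMk (σ C) = C := fun C ↦ C.out_eq
  -- The centre of the star; `s₀` exists because `x ≠ x₀`.
  set C₀ := Γ.connectedComponentMk s₀
  set γ : Γ.ConnectedComponent → HeckeAlgebra M := fun C ↦
    heckeT cs (alt cs (σ C₀).1 (σ C).1 (j (σ C₀) (σ C)) * w (σ C₀) (σ C)) -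
      heckeT cs (alt cs (σ C).1 (σ C₀).1 (j (σ C₀) (σ C)) * w (σ C₀) (σ C))
  have hne : ∀ C, C ≠ C₀ → σ C₀ ≠ σ C := by
    intro C hC h
    exact hC (by rw [← hσC C, ← h, hσC])
  have hnadj : ∀ C, C ≠ C₀ → ¬ Γ.Adj (σ C₀) (σ C) := by
    intro C hC h
    have := SimpleGraph.ConnectedComponent.connectedComponentMk_eq_of_adj h
    rw [hσC, hσC] at this
    exact hC this.symm
  refine ⟨γ '' {C₀}ᶜ, ?_, ?_, ?_⟩
  · rintro _ ⟨C, hC, rfl⟩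
    have hC : C ≠ C₀ := hC
    have horb : dihedralOrbit cs (σ C₀).1 (σ C).1 x =
        dihedralOrbit cs (σ C₀).1 (σ C).1 (w (σ C₀) (σ C) • x₀) :=
      (hp _ _).orbit_top (htop _ _)
    refine ⟨σ C₀, σ C, hne C hC, hnadj C hC, j (σ C₀) (σ C), w (σ C₀) (σ C), (hp _ _).pos, ?_, ?_,
      ?_, hw _ _, rfl⟩
    · rw [horb, (hp _ _).ncard_orbit]
    · rw [horb]; exact MulAction.mem_orbit_self _
    · intro z hz
      rw [horb] at hz
      rcases (hp _ _).eq_or_lt hz with h | h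
      · rw [h]
      · exact h.le
  · have hinj : Set.InjOn γ {C₀}ᶜ := by
      intro C hC D hD hCD
      have hC : C ≠ C₀ := hC
      have hD : D ≠ C₀ := hD
      by_contra hne'
      have hab : alt cs (σ C₀).1 (σ C).1 (j (σ C₀) (σ C)) * w (σ C₀) (σ C) ≠
          alt cs (σ C).1 (σ C₀).1 (j (σ C₀) (σ C)) * w (σ C₀) (σ C) := by
        rw [ne_eq, mul_left_inj]
        exact (hp _ _).alt_ne (hne C hC) (hnadj C hC) (htop _ _)
      obtain ⟨e1, e2⟩ := heckeT_sub_heckeT_inj hab hCD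
      have key : ∀ E, ∃ i, j (σ C₀) (σ E) = i + 1 := fun E ↦
        Nat.exists_eq_succ_of_ne_zero (hp _ _).pos.ne'
      have comp : ∀ (a : W) (u v : DescentAt cs ht x), IsShort cs ht x₀ a → a • x₀ = x →
          cs.length (cs.simple u.1 * a) < cs.length a →
          cs.length (cs.simple v.1 * a) < cs.length a →
          Γ.connectedComponentMk u = Γ.connectedComponentMk v := by
        intro a u v ha hax hu hv
        rcases ha.eq_or_adj hqp hax u v hu hv with h | h
        · rw [h]
        · exact SimpleGraph.ConnectedComponent.connectedComponentMk_eq_of_adj h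
      have desc : ∀ E, (cs.length (cs.simple (σ E).1 *
            (alt cs (σ C₀).1 (σ E).1 (j (σ C₀) (σ E)) * w (σ C₀) (σ E))) <
              cs.length (alt cs (σ C₀).1 (σ E).1 (j (σ C₀) (σ E)) * w (σ C₀) (σ E)) ∧
          cs.length (cs.simple (σ C₀).1 *
            (alt cs (σ E).1 (σ C₀).1 (j (σ C₀) (σ E)) * w (σ C₀) (σ E))) <
              cs.length (alt cs (σ E).1 (σ C₀).1 (j (σ C₀) (σ E)) * w (σ C₀) (σ E))) ∨
          (cs.length (cs.simple (σ C₀).1 *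
            (alt cs (σ C₀).1 (σ E).1 (j (σ C₀) (σ E)) * w (σ C₀) (σ E))) <
              cs.length (alt cs (σ C₀).1 (σ E).1 (j (σ C₀) (σ E)) * w (σ C₀) (σ E)) ∧
          cs.length (cs.simple (σ E).1 *
            (alt cs (σ E).1 (σ C₀).1 (j (σ C₀) (σ E)) * w (σ C₀) (σ E))) <
              cs.length (alt cs (σ E).1 (σ C₀).1 (j (σ C₀) (σ E)) * w (σ C₀) (σ E))) := by
        intro E
        obtain ⟨i, hi⟩ := key E
        have h1 := hp (σ C₀) (σ E)
        rw [hi] at h1 ⊢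
        have h2 := h1.length_simple_mul_lt hqp.scaled (hw _ _)
        have h3 := h1.symm.length_simple_mul_lt hqp.scaled (hw _ _)
        by_cases hev : Even i
        · simp only [hev, if_true] at h2 h3
          exact .inl ⟨h2, h3⟩
        · simp only [hev, if_false] at h2 h3
          exact .inr ⟨h2, h3⟩
      have ha := ((hp (σ C₀) (σ C)).isShort_alt_mul hqp.scaled (hw _ _) le_rfl).1
      have hb := ((hp (σ C₀) (σ C)).symm.isShort_alt_mul hqp.scaled (hw _ _) le_rfl).1
      have hax : (alt cs (σ C₀).1 (σ C).1 (j (σ C₀) (σ C)) * w (σ C₀) (σ C)) • x₀ = x := by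
        rw [mul_smul, htop]
      have hbx : (alt cs (σ C).1 (σ C₀).1 (j (σ C₀) (σ C)) * w (σ C₀) (σ C)) • x₀ = x := by
        rw [mul_smul, ← (hp _ _).meet, htop]
      have dC := desc C
      have dD := desc D
      rw [← e1, ← e2] at dD
      rcases dC with ⟨c1, c2⟩ | ⟨c1, c2⟩ <;> rcases dD with ⟨d1, d2⟩ | ⟨d1, d2⟩
      · have := comp _ _ _ ha hax c1 d1
        rw [hσC, hσC] at this
        exact hne' this
      · have := comp _ _ _ ha hax c1 d1
        rw [hσC, hσC] at this
        exact hC this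
      · have := comp _ _ _ ha hax c1 d1
        rw [hσC, hσC] at this
        exact hD this.symm
      · have := comp _ _ _ hb hbx c2 d2
        rw [hσC, hσC] at this
        exact hne' this
    rw [hinj.encard_image, ← Set.encard_singleton C₀, add_comm, Set.encard_add_encard_compl,
      Set.encard_univ]
  · intro J hGJ hlow
    have same : ∀ (s : DescentAt cs ht x) (a b : W), IsShort cs ht x₀ a → IsShort cs ht x₀ b →
        a • x₀ = x → b • x₀ = x → cs.length (cs.simple s.1 * a) < cs.length a →
        cs.length (cs.simple s.1 * b) < cs.length b →
        Cong ℤ[X] J (heckeT cs a) (heckeT cs b) := by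
      intro s a b ha hb hax hbx hsa hsb
      obtain ⟨a', rfl⟩ : ∃ v, a = cs.simple s.1 * v := ⟨cs.simple s.1 * a, by simp⟩
      obtain ⟨b', rfl⟩ : ∃ v, b = cs.simple s.1 * v := ⟨cs.simple s.1 * b, by simp⟩
      have hla := cs.length_simple_mul a' s.1
      have hlb := cs.length_simple_mul b' s.1
      rw [simple_mul_simple_cancel_left] at hsa hsb
      have hla : cs.length (cs.simple s.1 * a') = cs.length a' + 1 := by omega
      have hlb : cs.length (cs.simple s.1 * b') = cs.length b' + 1 := by omega
      rw [heckeT_simple_mul hla, heckeT_simple_mul hlb]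
      refine (hlow a' b' (ha.of_simple_mul hqp.scaled hla) (hb.of_simple_mul hqp.scaled hlb) ?_
        ?_).mul_left _
      · have := hax.trans hbx.symm
        rw [mul_smul, mul_smul] at this
        exact smul_left_cancel _ this
      · have h1 : cs.simple s.1 • x = a' • x₀ := by
          have := congrArg (cs.simple s.1 • ·) hax
          simpa [mul_smul, simple_smul_smul] using this.symm
        rw [← h1, s.2]
        omega
    set Rel : DescentAt cs ht x → DescentAt cs ht x → Prop := fun s t ↦
      ∀ a b : W, IsShort cs ht x₀ a → IsShort cs ht x₀ b → a • x₀ = x → b • x₀ = x →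
        cs.length (cs.simple s.1 * a) < cs.length a →
        cs.length (cs.simple t.1 * b) < cs.length b →
        Cong ℤ[X] J (heckeT cs a) (heckeT cs b)
    have hrefl : ∀ s, Rel s s := same
    have hsymm : ∀ s t, Rel s t → Rel t s := fun s t h a b ha hb hax hbx hsa hsb ↦
      (h b a hb ha hbx hax hsb hsa).symm
    -- The middle term is a short element over `x` with left descent `t`, built from one over `t x`.
    have htrans : ∀ s t u, Rel s t → Rel t u → Rel s u := by
      intro s t u h1 h2 a b ha hb hax hbx hsa hsb
      obtain ⟨v, hv, hvs⟩ := exists_isShort hqp heven hx₀ (cs.simple t.1 • x)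
      have hup : ht (cs.simple t.1 • v • x₀) = ht (v • x₀) + 1 := by
        rw [hv, simple_smul_smul, t.2]
        ring
      obtain ⟨h3, h4⟩ := hvs.simple_mul hqp.scaled hup
      have h5 : (cs.simple t.1 * v) • x₀ = x := by rw [mul_smul, hv, simple_smul_smul]
      have h6 : cs.length (cs.simple t.1 * (cs.simple t.1 * v)) < cs.length (cs.simple t.1 * v) := by
        rw [simple_mul_simple_cancel_left, h4]
        omega
      exact (h1 a _ ha h3 hax h5 hsa h6).trans (h2 _ b h3 hb h5 hbx h6 hsb)
    have hpair : ∀ s t : DescentAt cs ht x, Cong ℤ[X] J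
        (heckeT cs (alt cs s.1 t.1 (j s t) * w s t)) (heckeT cs (alt cs t.1 s.1 (j s t) * w s t)) →
        Rel s t := by
      intro s t hc a b ha hb hax hbx hsa hsb
      have h1 := ((hp s t).isShort_alt_mul hqp.scaled (hw s t) le_rfl).1
      have h2 := ((hp s t).symm.isShort_alt_mul hqp.scaled (hw s t) le_rfl).1
      have h1x : (alt cs s.1 t.1 (j s t) * w s t) • x₀ = x := by rw [mul_smul, htop]
      have h2x : (alt cs t.1 s.1 (j s t) * w s t) • x₀ = x := by
        rw [mul_smul, ← (hp s t).meet, htop]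
      obtain ⟨i, hi⟩ := Nat.exists_eq_succ_of_ne_zero (hp s t).pos.ne'
      have h3 := hp s t
      rw [hi] at h3 hc h1 h2 h1x h2x
      have h4 := h3.length_simple_mul_lt hqp.scaled (hw s t)
      have h5 := h3.symm.length_simple_mul_lt hqp.scaled (hw s t)
      by_cases hev : Even i
      · simp only [hev, if_true] at h4 h5
        exact (same s a _ ha h2 hax h2x hsa h5).trans
          (hc.symm.trans (same t _ b h1 hb h1x hbx h4 hsb))
      · simp only [hev, if_false] at h4 h5
        exact (same s a _ ha h1 hax h1x hsa h4).trans
          (hc.trans (same t _ b h2 hb h2x hbx h5 hsb))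
    -- Adjacency gives `j = m`, so both sides are the same group element.
    have hadj : ∀ s t, Γ.Adj s t → Rel s t := by
      intro s t ⟨hst, hM, hcard⟩
      apply hpair
      have hj : j s t = M s.1 t.1 := by
        have h1 := (hp s t).ncard_orbit
        rw [← (hp s t).orbit_top (htop s t)] at h1
        omega
      have e : alt cs s.1 t.1 (j s t) = alt cs t.1 s.1 (j s t) := by
        have h1 := alt_inv_mul_alt (cs := cs) s.1 t.1 (j s t)
        rw [hj, simple_mul_simple_pow] at h1
        rw [hj]
        exact (inv_mul_eq_one.1 h1).symm
      rw [e]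
      exact Cong.refl _ _ _
    have hreach : ∀ s t, Γ.connectedComponentMk s = Γ.connectedComponentMk t → Rel s t := by
      intro s t hst
      obtain ⟨p⟩ := SimpleGraph.ConnectedComponent.exact hst
      induction p with
      | nil => exact hrefl _
      | cons h _ ih =>
        exact htrans _ _ _ (hadj _ _ h)
          (ih (SimpleGraph.ConnectedComponent.sound ⟨by assumption⟩))
    have hstar : ∀ s, Rel (σ C₀) s := by
      intro s
      refine htrans _ (σ (Γ.connectedComponentMk s)) _ ?_ (hreach _ _ (hσC _))
      by_cases hC : Γ.connectedComponentMk s = C₀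
      · rw [hC]; exact hrefl _
      · exact hpair _ _ (cong_of_sub_mem (hGJ ⟨_, hC, rfl⟩))
    intro a b ha hb hax hbx
    obtain ⟨s, hs⟩ := hdesc a ha hax
    obtain ⟨t, htt⟩ := hdesc b hb hbx
    exact htrans _ _ _ (hsymm _ _ (hstar s)) (hstar t) a b ha hb hax hbx hs htt

end Transitive

end Quasiparabolic

namespace Quasiparabolic

open CoxeterSystem

variable {B W Y : Type*} [Group W] {M : CoxeterMatrix B} {cs : CoxeterSystem M W}
  [MulAction W Y] {ht : Y → ℤ} {ε : ℤ[X]} {x₀ : Y}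

/-! ### The annihilator -/

lemma IsDihedralGenerator.mem_annIdeal [MulAction.IsPretransitive W Y]
    (hqp : IsQuasiparabolic cs ht) (heven : IsEven cs Y) (hx₀ : IsWMinimal cs ht x₀)
    {φ : HeckeAlgebra M →ₐ[ℤ[X]] Module.End ℤ[X] (Y →₀ ℤ[X])} (hφ : IsHeckeAction cs ht ε φ)
    {x : Y} {g : HeckeAlgebra M} (h : IsDihedralGenerator cs ht x₀ x g) : g ∈ annIdeal φ x₀ := by
  obtain ⟨a, b, -, hax, hbx, ha, hb, rfl⟩ := h.exists_sub hqp heven hx₀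
  change φ _ (Finsupp.single x₀ 1) = 0
  rw [heckeAlgebra_sub_eq, map_add, map_smul, LinearMap.add_apply, LinearMap.smul_apply,
    isHeckeAction_heckeT_single hqp.scaled hφ ha, isHeckeAction_heckeT_single hqp.scaled hφ hb,
    hax, hbx, neg_one_smul, add_neg_cancel]

/-- An ideal modulo which `T(w)` depends only on `w • x₀` contains the annihilator. -/
lemma annIdeal_le_of_cong [MulAction.IsPretransitive W Y] (hqp : IsQuasiparabolic cs ht)
    (heven : IsEven cs Y) (hx₀ : IsWMinimal cs ht x₀)
    {φ : HeckeAlgebra M →ₐ[ℤ[X]] Module.End ℤ[X] (Y →₀ ℤ[X])} (hφ : IsHeckeAction cs ht ε φ)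
    {J : Ideal (HeckeAlgebra M)}
    (hJ : ∀ a b : W, IsShort cs ht x₀ a → IsShort cs ht x₀ b → a • x₀ = b • x₀ →
      Cong ℤ[X] J (heckeT cs a) (heckeT cs b)) : annIdeal φ x₀ ≤ J := by
  choose v hv hvs using exists_isShort hqp heven hx₀
  -- Modulo `J` this map commutes with the Hecke action, so `h = h ψ(T(x₀)) ≡ ψ(h T(x₀)) = 0` for
  -- `h` in the annihilator.
  set ψ : (Y →₀ ℤ[X]) →ₗ[ℤ[X]] HeckeAlgebra M :=
    Finsupp.linearCombination ℤ[X] fun x ↦ heckeT cs (v x)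
  have hψ : ∀ x, ψ (Finsupp.single x 1) = heckeT cs (v x) := fun x ↦ by simp [ψ]
  have hup : ∀ s x, ht (cs.simple s • x) = ht x + 1 →
      Cong ℤ[X] J (heckeGen M s * heckeT cs (v x)) (heckeT cs (v (cs.simple s • x))) := by
    intro s x h
    obtain ⟨h1, h2⟩ := (hvs x).simple_mul (s := s) hqp.scaled (by rwa [hv])
    rw [← heckeT_simple_mul h2]
    exact hJ _ _ h1 (hvs _) (by rw [hv, mul_smul, hv])
  have hsingle : ∀ s x, Cong ℤ[X] J (heckeGen M s * ψ (Finsupp.single x 1))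
      (ψ (φ (heckeGen M s) (Finsupp.single x 1))) := by
    intro s x
    rw [hφ s]
    rcases hqp.ht_simple heven s x with h | h
    · rw [heckeOp_single_of_lt (by omega), hψ, hψ]
      exact hup s x h
    · rw [heckeOp_single_of_gt (by omega), map_add, map_smul, map_smul, hψ, hψ]
      -- On a descent `T(v x) ≡ T(s) T(v (s x))`; multiplying by `T(s)` and expanding `T(s)²` gives
      -- both terms.
      have h1 := hup s (cs.simple s • x) (by rw [simple_smul_smul, h]; ring)
      rw [simple_smul_smul] at h1
      have h2 := h1.symm.mul_left (heckeGen M s)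
      rw [← mul_assoc, heckeGen_mul_self, add_mul, smul_mul_assoc, smul_mul_assoc, one_mul] at h2
      exact h2.trans ((h1.smul _).add (Cong.refl _ _ _))
  have hgen : ∀ s y, Cong ℤ[X] J (heckeGen M s * ψ y) (ψ (φ (heckeGen M s) y)) := by
    intro s y
    induction y using Finsupp.induction_linear with
    | zero => simpa using Cong.refl ℤ[X] J 0
    | add y z hy hz =>
      rw [map_add, map_add, map_add, mul_add]
      exact hy.add hz
    | single x c =>
      have e : Finsupp.single x c = c • Finsupp.single x (1 : ℤ[X]) := by simp
      rw [e, map_smul, map_smul, map_smul, mul_smul_comm]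
      exact (hsingle s x).smul c
  have hall : ∀ h y, Cong ℤ[X] J (h * ψ y) (ψ (φ h y)) := by
    intro h
    obtain ⟨a, rfl⟩ := RingQuot.mkAlgHom_surjective ℤ[X] (HeckeRel M) h
    induction a using FreeAlgebra.induction with
    | grade0 r =>
      intro y
      rw [AlgHom.commutes, AlgHom.commutes, Module.algebraMap_end_apply, map_smul,
        ← Algebra.smul_def]
      exact Cong.refl _ _ _
    | grade1 s => exact hgen s
    | mul a b ha hb =>
      intro y
      rw [map_mul, map_mul, Module.End.mul_apply, mul_assoc]
      exact ((hb y).mul_left _).trans (ha _)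
    | add a b ha hb =>
      intro y
      rw [map_add, map_add, LinearMap.add_apply, map_add, add_mul]
      exact (ha y).add (hb y)
  intro h hh
  have hh : φ h (Finsupp.single x₀ 1) = 0 := hh
  have h1 := hall h (Finsupp.single x₀ 1)
  have hv1 : v x₀ = 1 := by
    have := hvs x₀
    rw [IsShort, hv] at this
    rw [← cs.length_eq_zero_iff]
    omega
  rw [hψ, hv1, heckeT_one, mul_one, hh, map_zero, Cong, smul_zero, add_zero] at h1
  exact h1

lemma IsShort.eq_one {a : W} (ha : IsShort cs ht x₀ a) (h : a • x₀ = x₀) : a = 1 := by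
  rw [IsShort, h] at ha
  rw [← cs.length_eq_zero_iff]
  omega

lemma not_isDihedralGenerator_min (hx₀ : IsWMinimal cs ht x₀) (g : HeckeAlgebra M) :
    ¬ IsDihedralGenerator cs ht x₀ x₀ g := by
  rintro ⟨s, -⟩
  have h1 := hx₀ s.1
  have h2 := s.2
  omega

/-- The dihedral generators of the annihilator of `T(x₀)`. -/
theorem exists_generators [Finite B] [MulAction.IsPretransitive W Y]
    (hqp : IsQuasiparabolic cs ht) (heven : IsEven cs Y) (hx₀ : IsWMinimal cs ht x₀)
    {φ : HeckeAlgebra M →ₐ[ℤ[X]] Module.End ℤ[X] (Y →₀ ℤ[X])} (hφ : IsHeckeAction cs ht ε φ) :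
    ∃ G : Set (HeckeAlgebra M), Ideal.span G = annIdeal φ x₀ ∧
      (∀ g ∈ G, ∃ x : Y, IsDihedralGenerator cs ht x₀ x g) ∧
      (∀ x : Y, x ≠ x₀ → {g ∈ G | IsDihedralGenerator cs ht x₀ x g}.encard + 1 =
        ENat.card (descentGraph cs ht x).ConnectedComponent) ∧
      {g ∈ G | IsDihedralGenerator cs ht x₀ x₀ g} = ∅ ∧
      (Finite Y → G.Finite) := by
  choose G hG hcard hcong using fun x : {x : Y // x ≠ x₀} ↦
    exists_generators_at hqp heven hx₀ x.2
  -- Generators with different bases differ, so the union adds nothing based at `x` to `G x`.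
  have hsep : ∀ x : {x : Y // x ≠ x₀},
      {g ∈ ⋃ y, G y | IsDihedralGenerator cs ht x₀ x.1 g} = G x := by
    intro x
    ext g
    simp only [Set.mem_ofPred_eq, Set.mem_iUnion]
    constructor
    · rintro ⟨⟨y, hy⟩, hg⟩
      obtain rfl : y = x := Subtype.ext ((hG y g hy).base_eq hqp heven hx₀ hg)
      exact hy
    · exact fun hg ↦ ⟨⟨x, hg⟩, hG x g hg⟩
  refine ⟨⋃ x, G x, le_antisymm ?_ ?_, ?_, ?_, ?_, ?_⟩
  · rw [Ideal.span_le]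
    intro g hg
    obtain ⟨x, hx⟩ := Set.mem_iUnion.1 hg
    exact (hG x g hx).mem_annIdeal hqp heven hx₀ hφ
  · refine annIdeal_le_of_cong hqp heven hx₀ hφ fun a b ha hb hab ↦ ?_
    -- For short elements lower height over `x₀` means smaller length.
    induction hn : cs.length a using Nat.strong_induction_on generalizing a b with
    | _ n ih =>
    by_cases hx : a • x₀ = x₀
    · rw [ha.eq_one hx, hb.eq_one (hab ▸ hx)]
      exact Cong.refl _ _ _
    · refine hcong ⟨a • x₀, hx⟩ _
        ((Set.subset_iUnion G _).trans Ideal.subset_span) ?_ a b ha hb rfl hab.symm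
      intro c d hc hd hcd hlt
      refine ih (cs.length c) ?_ c d hc hd hcd rfl
      unfold IsShort at hc ha
      rw [hc, ha] at hlt
      omega
  · intro g hg
    obtain ⟨x, hx⟩ := Set.mem_iUnion.1 hg
    exact ⟨x, hG x g hx⟩
  · intro x hx
    rw [hsep ⟨x, hx⟩]
    exact hcard ⟨x, hx⟩
  · ext g
    simp [not_isDihedralGenerator_min hx₀ g]
  · intro _
    refine Set.finite_iUnion fun x ↦ ?_
    rw [← Set.encard_ne_top_iff]
    intro htop
    have h1 := hcard x
    rw [htop, top_add] at h1
    have : Finite (descentGraph cs ht x.1).ConnectedComponent := Quot.finite _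
    exact ENat.card_lt_top.2 this |>.ne h1.symm

end Quasiparabolic

/-! ### Module structure and generators combined -/

theorem mainTheorem10 {B W Y : Type*} [Finite B] [Group W] {M : CoxeterMatrix B}
    (cs : CoxeterSystem M W) [MulAction W Y] [MulAction.IsPretransitive W Y] (ht : Y → ℤ)
    (hqp : Quasiparabolic.IsQuasiparabolic cs ht) (heven : Quasiparabolic.IsEven cs Y)
    (x₀ : Y) (hx₀ : Quasiparabolic.IsWMinimal cs ht x₀)
    (ε : Polynomial ℤ) (hε : ε = Polynomial.X ∨ ε = -1) :
    (∃! φ : Quasiparabolic.HeckeAlgebra M →ₐ[Polynomial ℤ]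
        Module.End (Polynomial ℤ) (Y →₀ Polynomial ℤ),
      Quasiparabolic.IsHeckeAction cs ht ε φ) ∧
    ∀ φ : Quasiparabolic.HeckeAlgebra M →ₐ[Polynomial ℤ]
        Module.End (Polynomial ℤ) (Y →₀ Polynomial ℤ),
      Quasiparabolic.IsHeckeAction cs ht ε φ →
      (∃ G : Set (Quasiparabolic.HeckeAlgebra M),
        Ideal.span G = Quasiparabolic.annIdeal φ x₀ ∧
        (∀ g ∈ G, ∃ x : Y, Quasiparabolic.IsDihedralGenerator cs ht x₀ x g) ∧
        (∀ x : Y, x ≠ x₀ →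
          {g ∈ G | Quasiparabolic.IsDihedralGenerator cs ht x₀ x g}.encard + 1 =
            ENat.card (Quasiparabolic.descentGraph cs ht x).ConnectedComponent) ∧
        {g ∈ G | Quasiparabolic.IsDihedralGenerator cs ht x₀ x₀ g} = ∅ ∧
        (Finite Y → G.Finite)) ∧
      (Finite Y → (Quasiparabolic.annIdeal φ x₀).FG) := by
  refine ⟨Quasiparabolic.existsUnique_isHeckeAction hqp heven hx₀ ε, fun φ hφ ↦ ?_⟩
  obtain ⟨G, hG⟩ := Quasiparabolic.exists_generators hqp heven hx₀ hφ
  refine ⟨⟨G, hG⟩, fun hY ↦ ⟨(hG.2.2.2.2 hY).toFinset, ?_⟩⟩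
  rw [Set.Finite.coe_toFinset]
  exact hG.1
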